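/- Let $p$ be a prime, let $d\ge 1$, and let $G$ be a topological group isomorphic to $\mathbb{Z}_p^d$. Let $\Lambda=\mathbb{Z}_p[[G]]=\varprojlim_U\mathbb{Z}_p[G/U]$ be its completed group algebra, where $U$ runs through the open subgroups of $G$. Let $M$ be a $\Lambda$-module which is finitely generated or which can be given the structure of a compact Hausdorff topological $\Lambda$-module. For an open subgroup $U$ let $M_U$ be the largest quotient of $M$ on which $U$ acts trivially, and suppose that $M$ is systematically coinvariant-finite, that is, $M_U$ is finite for every open subgroup $U$ of $G$. For open subgroups $V\subseteq U$ let $N_{U/V}\colon M_U\to M_V$ be the norm map, which sends $x$ to $\sum_{\tau\in U/V}\tau\tilde{x}$ for any lift $\tilde{x}\in M_V$ of $x$, and let $\varinjlim_U M_U$ be the direct limit with respect to these maps, regarded as a discrete $\Lambda$-module. Then there is an isomorphism of $\Lambda$-modules $$\mathrm{Ext}^1_{\Lambda}(M,\Lambda)\;\cong\;\Big(\varinjlim_U M_U\Big)^\vee,$$ where $(-)^\vee$ is the Pontryagin dual. Here $\Lambda$, being commutative, acts on $\mathrm{Ext}^1_\Lambda(M,\Lambda)$ in the usual way and on the dual by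 $(\lambda\varphi)(x)=\varphi(\lambda x)$. (Equivalently, one may twist both actions by the involution $g\mapsto g^{-1}$ of $G$.) -/

import Mathlib

/-! # Coinvariants, norm maps and Pontryagin duals over completed group algebras -/

open CategoryTheory

universe u v

noncomputable section

namespace Iwasawa

section Algebra

variable (p : ℕ) [Fact p.Prime] (G : Type u) [CommGroup G] [TopologicalSpace G]

/-- The natural projection `ℤ_p[G/V] → ℤ_p[G/U]` for open subgroups `V ≤ U` of `G`. -/
def groupRingProj {V U : OpenSubgroup G} (h : V ≤ U) :
    MonoidAlgebra ℤ_[p] (G ⧸ V.toSubgroup) →ₐ[ℤ_[p]] MonoidAlgebra ℤ_[p] (G ⧸ U.toSubgroup) :=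
  MonoidAlgebra.mapDomainAlgHom ℤ_[p] ℤ_[p]
    (QuotientGroup.map V.toSubgroup U.toSubgroup (MonoidHom.id G) h)

/-- The inverse limit of the group algebras `ℤ_p[G/U]` over all open subgroups `U` of `G`, realised
as the subalgebra of compatible families in the product. -/
def compatibleFamilies :
    Subalgebra ℤ_[p] (∀ U : OpenSubgroup G, MonoidAlgebra ℤ_[p] (G ⧸ U.toSubgroup)) where
  carrier := {x | ∀ (V U : OpenSubgroup G) (h : V ≤ U), groupRingProj p G h (x V) = x U}
  mul_mem' := fun hx hy V U h => by simp [hx V U h, hy V U h]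
  add_mem' := fun hx hy V U h => by simp [hx V U h, hy V U h]
  algebraMap_mem' := fun r V U h => by
    simp only [Pi.algebraMap_apply]
    exact (groupRingProj p G h).commutes r

/-- The completed group algebra `ℤ_p⟦G⟧`. -/
def CompletedGroupAlgebra : Type u := compatibleFamilies p G

instance : CommRing (CompletedGroupAlgebra p G) :=
  inferInstanceAs (CommRing (compatibleFamilies p G))

instance : Algebra ℤ_[p] (CompletedGroupAlgebra p G) :=
  inferInstanceAs (Algebra ℤ_[p] (compatibleFamilies p G))

variable {G}

/-- The canonical homomorphism from `G` to the unit group of `ℤ_p⟦G⟧`, as a map into `ℤ_p⟦G⟧`. -/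
def groupElt : G →* CompletedGroupAlgebra p G where
  toFun g := ⟨fun U => MonoidAlgebra.of ℤ_[p] (G ⧸ U.toSubgroup) (g : G ⧸ U.toSubgroup), by
    intro V U h
    simp only [groupRingProj, MonoidAlgebra.of_apply, MonoidAlgebra.mapDomainAlgHom_apply,
      MonoidAlgebra.mapDomain_single]
    rfl⟩
  map_one' := Subtype.ext (funext fun U => map_one (MonoidAlgebra.of ℤ_[p] (G ⧸ U.toSubgroup)))
  map_mul' a b := Subtype.ext (funext fun U =>
    map_mul (MonoidAlgebra.of ℤ_[p] (G ⧸ U.toSubgroup)) (a : G ⧸ U.toSubgroup) b)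

variable (G)

/-- The profinite topology of `ℤ_p⟦G⟧`, that is, the inverse limit topology, where `ℤ_p[G/U]` has
the product topology of its `ℤ_p`-coefficients. -/
instance completedGroupAlgebraTopology : TopologicalSpace (CompletedGroupAlgebra p G) :=
  TopologicalSpace.induced
    (fun x (i : Σ U : OpenSubgroup G, G ⧸ U.toSubgroup) => (x.1 i.1).coeff i.2) inferInstance

/-- `M` can be given a topology that makes it a compact Hausdorff topological
`ℤ_p⟦G⟧`-module. -/
def IsCompactModule (M : Type v) [AddCommGroup M] [Module (CompletedGroupAlgebra p G) M] : Prop :=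
  ∃ _ : TopologicalSpace M, CompactSpace M ∧ T2Space M ∧ IsTopologicalAddGroup M ∧
    ContinuousSMul (CompletedGroupAlgebra p G) M

end Algebra

section Coinvariants

variable (p : ℕ) [Fact p.Prime] (G : Type u) [CommGroup G] [TopologicalSpace G]
variable (M : Type v) [AddCommGroup M] [Module (CompletedGroupAlgebra p G) M]

/-- The submodule of `M` generated by the elements `u • m - m` with `u ∈ U` and `m ∈ M`. -/
def augmentationSubmodule (U : OpenSubgroup G) : Submodule (CompletedGroupAlgebra p G) M :=
  Submodule.span (CompletedGroupAlgebra p G) {x | ∃ u ∈ U, ∃ m : M, x = groupElt p u • m - m}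

/-- The coinvariants `M_U`: the largest quotient of `M` on which `U` acts trivially. -/
abbrev Coinv (U : OpenSubgroup G) : Type v := M ⧸ augmentationSubmodule p G M U

theorem groupElt_smul_coinv (U : OpenSubgroup G) {u : G} (hu : u ∈ U) (x : Coinv p G M U) :
    groupElt p u • x = x := by
  obtain ⟨m, rfl⟩ := Submodule.Quotient.mk_surjective _ x
  rw [← Submodule.Quotient.mk_smul, Submodule.Quotient.eq]
  exact Submodule.subset_span ⟨u, hu, m, rfl⟩

/-- `M` is systematically coinvariant-finite: `M_U` is finite for every open subgroup `U`. -/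
def SystematicallyCoinvariantFinite : Prop :=
  ∀ U : OpenSubgroup G, Finite (Coinv p G M U)

/-- The action of `G/V` on the coinvariants `M_V`. -/
def cosetAction (V : OpenSubgroup G) :
    G ⧸ V.toSubgroup →* Module.End (CompletedGroupAlgebra p G) (Coinv p G M V) :=
  QuotientGroup.lift V.toSubgroup
    ((Algebra.lsmul (CompletedGroupAlgebra p G) (CompletedGroupAlgebra p G)
      (Coinv p G M V)).toRingHom.toMonoidHom.comp (groupElt p))
    (fun v hv => by
      refine LinearMap.ext fun x => ?_
      exact groupElt_smul_coinv p G M V hv x)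

theorem cosetAction_mk (V : OpenSubgroup G) (g : G) (x : Coinv p G M V) :
    cosetAction p G M V (g : G ⧸ V.toSubgroup) x = groupElt p g • x := rfl

variable [IsTopologicalGroup G] [CompactSpace G]

/-- For open subgroups `V`, `U` of `G`, the image of `U` in `G/V` (which is `U/V` if `V ≤ U`). -/
abbrev cosetGroup (V U : OpenSubgroup G) : Subgroup (G ⧸ V.toSubgroup) :=
  U.toSubgroup.map (QuotientGroup.mk' V.toSubgroup)

instance cosetGroupFintype (V U : OpenSubgroup G) : Fintype (cosetGroup G V U) :=
  haveI : Finite (G ⧸ V.toSubgroup) := Subgroup.quotient_finite_of_isOpen V.toSubgroup V.isOpen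
  Fintype.ofFinite _

/-- The norm `∑_{τ ∈ U/V} τ` on `M_V`. -/
def normEnd (V U : OpenSubgroup G) : Module.End (CompletedGroupAlgebra p G) (Coinv p G M V) :=
  ∑ τ : cosetGroup G V U, cosetAction p G M V (τ : G ⧸ V.toSubgroup)

theorem normEnd_groupElt_smul (V U : OpenSubgroup G) {u : G} (hu : u ∈ U) (x : Coinv p G M V) :
    normEnd p G M V U (groupElt p u • x) = normEnd p G M V U x := by
  have huq : (u : G ⧸ V.toSubgroup) ∈ cosetGroup G V U := ⟨u, hu, rfl⟩
  simp only [normEnd, LinearMap.sum_apply]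
  rw [← cosetAction_mk p G M]
  refine Fintype.sum_equiv (Equiv.mulRight (⟨(u : G ⧸ V.toSubgroup), huq⟩ : cosetGroup G V U))
    _ _ (fun τ => ?_)
  simp [map_mul]

/-- The norm map `N_{U/V} : M_U → M_V`, `x ↦ ∑_{τ ∈ U/V} τ x̃`, where `x̃ ∈ M_V` is any lift
of `x`. -/
def normMap (V U : OpenSubgroup G) :
    Coinv p G M U →ₗ[CompletedGroupAlgebra p G] Coinv p G M V :=
  (augmentationSubmodule p G M U).liftQ
    ((normEnd p G M V U).comp (augmentationSubmodule p G M V).mkQ) (by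
      rw [augmentationSubmodule, Submodule.span_le]
      rintro x ⟨u, hu, m, rfl⟩
      have h := normEnd_groupElt_smul p G M V U hu ((augmentationSubmodule p G M V).mkQ m)
      simp only [SetLike.mem_coe, LinearMap.mem_ker, LinearMap.comp_apply, map_sub]
      rw [sub_eq_zero, ← h, map_smul])

theorem normMap_mkQ (V U : OpenSubgroup G) (m : M) :
    normMap p G M V U ((augmentationSubmodule p G M U).mkQ m) =
      ∑ τ : cosetGroup G V U, cosetAction p G M V (τ : G ⧸ V.toSubgroup)
        ((augmentationSubmodule p G M V).mkQ m) :=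
  LinearMap.sum_apply _ _ _

/-- The coinvariants and the norm maps form a direct system. -/
instance normMap_directedSystem :
    DirectedSystem (ι := (OpenSubgroup G)ᵒᵈ) (fun U => Coinv p G M (OrderDual.ofDual U))
      (fun U V _ => normMap p G M (OrderDual.ofDual V) (OrderDual.ofDual U)) where
  map_self U x := by
    obtain ⟨m, rfl⟩ := Submodule.mkQ_surjective _ x
    rw [normMap_mkQ, Fintype.sum_eq_single 1]
    · rw [Subgroup.coe_one, map_one, Module.End.one_apply]
    · rintro ⟨_, u, hu, rfl⟩ h
      refine absurd (Subtype.ext ?_) h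
      exact (QuotientGroup.eq_one_iff u).2 hu
  map_map U V W hWV hVU x := by
    obtain ⟨m, rfl⟩ := Submodule.mkQ_surjective _ x
    induction U using OrderDual.rec with | _ U
    induction V using OrderDual.rec with | _ V
    induction W using OrderDual.rec with | _ W
    replace hVU : U ≤ V := hVU
    replace hWV : V ≤ W := hWV
    change normMap p G M U V (normMap p G M V W ((augmentationSubmodule p G M W).mkQ m)) =
      normMap p G M U W ((augmentationSubmodule p G M W).mkQ m)
    have hrep : ∀ τ : cosetGroup G V W, ∃ g ∈ W, (g : G ⧸ V.toSubgroup) = τ := by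
      rintro ⟨_, u, hu, rfl⟩
      exact ⟨u, hu, rfl⟩
    choose r hrW hr using hrep
    have key : ∀ τ : cosetGroup G V W, cosetAction p G M V (τ : G ⧸ V.toSubgroup)
        ((augmentationSubmodule p G M V).mkQ m) =
        (augmentationSubmodule p G M V).mkQ (groupElt p (r τ) • m) := by
      intro τ
      rw [← hr τ, cosetAction_mk, map_smul]
    rw [normMap_mkQ, normMap_mkQ, map_sum]
    simp_rw [key, normMap_mkQ]
    rw [← Fintype.sum_prod_type']
    have hmem : ∀ x : cosetGroup G V W × cosetGroup G U V,
        (x.2 : G ⧸ U.toSubgroup) * (r x.1 : G ⧸ U.toSubgroup) ∈ cosetGroup G U W := by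
      rintro ⟨τ, _, v, hv, rfl⟩
      exact ⟨v * r τ, W.mul_mem (hWV hv) (hrW τ), rfl⟩
    refine Fintype.sum_bijective (fun x => ⟨_, hmem x⟩) ⟨?_, ?_⟩ _ _ ?_
    · rintro ⟨τ, ⟨_, v, hv, rfl⟩⟩ ⟨τ', ⟨_, v', hv', rfl⟩⟩ h
      have h1 : ((v * r τ : G) : G ⧸ U.toSubgroup) = ((v' * r τ' : G) : G ⧸ U.toSubgroup) :=
        congrArg Subtype.val h
      have h2 : ((v * r τ : G) : G ⧸ V.toSubgroup) = ((v' * r τ' : G) : G ⧸ V.toSubgroup) :=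
        QuotientGroup.eq.2 (hVU (QuotientGroup.eq.1 h1))
      rw [QuotientGroup.mk_mul, QuotientGroup.mk_mul, (QuotientGroup.eq_one_iff v).2 hv,
        (QuotientGroup.eq_one_iff v').2 hv', one_mul, one_mul, hr, hr] at h2
      obtain rfl := Subtype.ext h2
      rw [QuotientGroup.mk_mul, QuotientGroup.mk_mul, mul_left_inj] at h1
      exact Prod.ext rfl (Subtype.ext h1)
    · rintro ⟨_, u, hu, rfl⟩
      have hq : (u : G ⧸ V.toSubgroup) ∈ cosetGroup G V W := ⟨u, hu, rfl⟩
      have hv : u * (r ⟨_, hq⟩)⁻¹ ∈ V := by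
        refine (QuotientGroup.eq_one_iff (N := V.toSubgroup) _).1 ?_
        rw [QuotientGroup.mk_mul, QuotientGroup.mk_inv, hr, mul_inv_cancel]
      refine ⟨⟨⟨_, hq⟩, ⟨_, u * (r ⟨_, hq⟩)⁻¹, hv, rfl⟩⟩, Subtype.ext ?_⟩
      change ((u * (r ⟨_, hq⟩)⁻¹ : G) : G ⧸ U.toSubgroup) * (r ⟨_, hq⟩ : G) = u
      rw [← QuotientGroup.mk_mul, inv_mul_cancel_right]
    · rintro ⟨τ, σ⟩
      rw [map_mul, Module.End.mul_apply, cosetAction_mk, map_smul]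

open Classical in
/-- The direct limit of the coinvariants `M_U`, over the open subgroups `U` of `G` ordered by
reverse inclusion, with respect to the norm maps. -/
def NormLimit : Type (max u v) :=
  Module.DirectLimit (R := CompletedGroupAlgebra p G) (ι := (OpenSubgroup G)ᵒᵈ)
    (fun U => Coinv p G M (OrderDual.ofDual U))
    (fun U V _ => normMap p G M (OrderDual.ofDual V) (OrderDual.ofDual U))

open Classical in
instance : AddCommGroup (NormLimit p G M) :=
  inferInstanceAs (AddCommGroup (Module.DirectLimit (R := CompletedGroupAlgebra p G)
    (ι := (OpenSubgroup G)ᵒᵈ) (fun U => Coinv p G M (OrderDual.ofDual U))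
    (fun U V _ => normMap p G M (OrderDual.ofDual V) (OrderDual.ofDual U))))

open Classical in
instance : Module (CompletedGroupAlgebra p G) (NormLimit p G M) :=
  inferInstanceAs (Module (CompletedGroupAlgebra p G)
    (Module.DirectLimit (R := CompletedGroupAlgebra p G)
    (ι := (OpenSubgroup G)ᵒᵈ) (fun U => Coinv p G M (OrderDual.ofDual U))
    (fun U V _ => normMap p G M (OrderDual.ofDual V) (OrderDual.ofDual U))))

/-- The direct limit is regarded as a discrete module. -/
instance : TopologicalSpace (NormLimit p G M) := ⊥

instance : DiscreteTopology (NormLimit p G M) := ⟨rfl⟩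

end Coinvariants

section Dual

/-- The Pontryagin dual of a topological abelian group, in additive notation. -/
def Dual (L : Type v) [AddCommGroup L] [TopologicalSpace L] : Type v :=
  Additive (PontryaginDual (Multiplicative L))

instance (L : Type v) [AddCommGroup L] [TopologicalSpace L] : AddCommGroup (Dual L) :=
  inferInstanceAs (AddCommGroup (Additive (PontryaginDual (Multiplicative L))))

/-- The value of a character at a point. -/
def Dual.eval {L : Type v} [AddCommGroup L] [TopologicalSpace L] (φ : Dual L) (x : L) : Circle :=
  (Additive.toMul φ : PontryaginDual (Multiplicative L)) (Multiplicative.ofAdd x)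

theorem Dual.ext {L : Type v} [AddCommGroup L] [TopologicalSpace L] {φ ψ : Dual L}
    (h : ∀ x, φ.eval x = ψ.eval x) : φ = ψ :=
  PontryaginDual.ext (A := Multiplicative L) fun x => h x.toAdd

section Eval

variable {L : Type v} [AddCommGroup L] [TopologicalSpace L]

theorem Dual.add_eval (φ ψ : Dual L) (x : L) : (φ + ψ).eval x = φ.eval x * ψ.eval x := rfl

theorem Dual.zero_eval (x : L) : (0 : Dual L).eval x = 1 := rfl

theorem Dual.eval_add (φ : Dual L) (x y : L) : φ.eval (x + y) = φ.eval x * φ.eval y :=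
  map_mul (Additive.toMul φ : PontryaginDual (Multiplicative L)) _ _

theorem Dual.eval_zero (φ : Dual L) : φ.eval 0 = 1 :=
  map_one (Additive.toMul φ : PontryaginDual (Multiplicative L))

end Eval

variable (R : Type u) [CommRing R] (L : Type v) [AddCommGroup L] [Module R L]
  [TopologicalSpace L] [DiscreteTopology L]

/-- Multiplication by `r` as a continuous endomorphism of the discrete module `L`. -/
def discreteSMul (r : R) : Multiplicative L →ₜ* Multiplicative L where
  toMonoidHom := AddMonoidHom.toMultiplicative (DistribSMul.toAddMonoidHom L r)
  continuous_toFun := continuous_of_discreteTopology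

instance : SMul R (Dual L) where
  smul r φ := Additive.ofMul
    (PontryaginDual.map (discreteSMul R L r) (Additive.toMul φ : PontryaginDual (Multiplicative L)))

variable {R L}

theorem Dual.smul_eval (r : R) (φ : Dual L) (x : L) : (r • φ).eval x = φ.eval (r • x) := rfl

/-- The `R`-module structure on the Pontryagin dual of a discrete `R`-module (`R` commutative):
`(r • φ) x = φ (r • x)`. -/
instance dualModule : Module R (Dual L) where
  one_smul φ := Dual.ext fun x => by rw [Dual.smul_eval, one_smul]
  mul_smul r s φ := Dual.ext fun x => by
    rw [Dual.smul_eval, Dual.smul_eval, Dual.smul_eval, mul_comm, mul_smul]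
  smul_zero r := Dual.ext fun x => by rw [Dual.smul_eval, Dual.zero_eval, Dual.zero_eval]
  smul_add r φ ψ := Dual.ext fun x => by
    rw [Dual.smul_eval, Dual.add_eval, Dual.add_eval, Dual.smul_eval, Dual.smul_eval]
  add_smul r s φ := Dual.ext fun x => by
    rw [Dual.smul_eval, Dual.add_eval, add_smul, Dual.eval_add, Dual.smul_eval, Dual.smul_eval]
  zero_smul φ := Dual.ext fun x => by
    rw [Dual.smul_eval, zero_smul, Dual.eval_zero, Dual.zero_eval]

end Dual

end Iwasawa

end

/-! Write `Λ` for `ℤ_p⟦G⟧` and `Q` for the inverse limit of the group algebras `ℚ_p[G/U]`. The proof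
shifts dimension along `0 → Λ → Q → Q/Λ → 0` and then computes `Hom(M, Q/Λ)` as a dual.

For the shift, `M` may be assumed finitely generated: in the compact case this is a topological
Nakayama argument (`IsCompactModule.finite`). Since `M_U` is finite, it is killed by some `p ^ k`,
so `p ^ k` maps `M` into `I_U M`, where `I_U` is generated by the `u - 1`. Cayley–Hamilton then
gives an element of `Λ` that kills `M` and becomes a power of `p` in `ℤ_p[G/U]`
(`exists_annihilator_proj_eq_pow`). That power is invertible in `ℚ_p[G/U]`, which forces both
`Hom(M, Q)` and `Ext¹(M, Q)` to vanish. Hence `Ext¹(M, Λ) ≅ Hom(M, Q/Λ)`.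

For the dual, compose `h : M → Q/Λ` with the coefficient at `1 ∈ G/U` and with the character
`ℚ_p/ℤ_p → Circle`. The result factors through `M_U`. Compatibility of elements of `Q` under `G/V →
G/U` is exactly compatibility of these characters with the norm maps, so `h` yields a character of
the direct limit. Translates under `G` recover all coefficients, which gives injectivity.
Conversely, a character of the limit prescribes all coefficients modulo `ℤ_p`; a compatible lift to
`ℚ_p` exists by compactness of the cosets of `ℤ_p` (`exists_ratGroupAlgebra_lift`), and the
resulting map is `Λ`-linear because the kernel of `Λ → ℤ_p[G/U]` is algebraically generated by the
`u - 1` (`mem_augIdeal_iff`). -/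

noncomputable section

namespace Iwasawa

/-! ### The character of `ℚ_p` with kernel `ℤ_p`. -/

section PadicCharacter

variable {p : ℕ} [Fact p.Prime]

/-- The character `y ↦ exp (2πi y / p ^ n)` of `ℤ_p`. -/
def levelChar (n : ℕ) : ℤ_[p] →+ Additive Circle :=
  (AddChar.toAddMonoidHom (ZMod.toCircle (N := p ^ n))).comp
    (PadicInt.toZModPow n : ℤ_[p] →+* ZMod (p ^ n)).toAddMonoidHom

theorem levelChar_apply (n : ℕ) (y : ℤ_[p]) :
    levelChar n y = Additive.ofMul (ZMod.toCircle (PadicInt.toZModPow n y)) := rfl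

theorem levelChar_eq_zero_iff (n : ℕ) (y : ℤ_[p]) : levelChar n y = 0 ↔ (p : ℤ_[p]) ^ n ∣ y := by
  rw [← Ideal.mem_span_singleton, ← PadicInt.ker_toZModPow, RingHom.mem_ker, levelChar_apply,
    ofMul_eq_zero, ← AddChar.map_zero_eq_one (ZMod.toCircle (N := p ^ n)),
    ZMod.injective_toCircle.eq_iff]

/-- Both sides depend only on `y` modulo `p ^ (n + 1)`, so `y` may be replaced by a natural number,
where the exponential formula is explicit. -/
theorem levelChar_succ_mul (n : ℕ) (y : ℤ_[p]) :
    levelChar (n + 1) ((p : ℤ_[p]) * y) = levelChar n y := by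
  obtain ⟨j, hj⟩ : ∃ j : ℕ, (p : ℤ_[p]) ^ (n + 1) ∣ y - j :=
    ⟨_, Ideal.mem_span_singleton.1 (PadicInt.appr_spec (n + 1) y)⟩
  have h1 : levelChar (n + 1) ((p : ℤ_[p]) * y) = levelChar (n + 1) ((p * j : ℕ) : ℤ_[p]) := by
    rw [← sub_eq_zero, ← map_sub, levelChar_eq_zero_iff]
    push_cast
    rw [← mul_sub]
    exact hj.mul_left _
  have h2 : levelChar n y = levelChar n (j : ℤ_[p]) := by
    rw [← sub_eq_zero, ← map_sub, levelChar_eq_zero_iff]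
    exact (pow_dvd_pow _ n.le_succ).trans hj
  have hp : (p : ℂ) ≠ 0 := Nat.cast_ne_zero.2 (Fact.out : p.Prime).ne_zero
  rw [h1, h2, levelChar_apply, levelChar_apply, map_natCast (PadicInt.toZModPow _),
    map_natCast (PadicInt.toZModPow _)]
  congr 1
  ext
  rw [ZMod.toCircle_natCast, ZMod.toCircle_natCast]
  congr 1
  push_cast
  field_simp
  ring

theorem levelChar_add_mul (n k : ℕ) (y : ℤ_[p]) :
    levelChar (n + k) ((p : ℤ_[p]) ^ k * y) = levelChar n y := by
  induction k with
  | zero => simp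
  | succ k ih => rw [← add_assoc, pow_succ', mul_assoc, levelChar_succ_mul, ih]

theorem exists_pow_mul_eq_coe (x : ℚ_[p]) : ∃ (n : ℕ) (y : ℤ_[p]), (p : ℚ_[p]) ^ n * x = y := by
  obtain ⟨n, hn⟩ := exists_nat_gt ‖x‖
  have hp : (1 : ℝ) < p := by exact_mod_cast (Fact.out : p.Prime).one_lt
  obtain ⟨k, hk⟩ := pow_unbounded_of_one_lt (‖x‖) hp
  refine ⟨k, ⟨(p : ℚ_[p]) ^ k * x, ?_⟩, rfl⟩
  rw [norm_mul, norm_pow, Padic.norm_p, inv_pow, inv_mul_le_iff₀ (by positivity)]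
  linarith

variable (p) in
/-- The exponent of a power of `p` that clears the denominator. -/
def denExp (x : ℚ_[p]) : ℕ := (exists_pow_mul_eq_coe x).choose

/-- The numerator of `x` over `p ^ denExp p x`. -/
def num (x : ℚ_[p]) : ℤ_[p] := (exists_pow_mul_eq_coe x).choose_spec.choose

theorem pow_denExp_mul (x : ℚ_[p]) : (p : ℚ_[p]) ^ denExp p x * x = num x :=
  (exists_pow_mul_eq_coe x).choose_spec.choose_spec

/-- The value does not depend on the chosen denominator; this makes `padicChar` additive although
`denExp` and `num` are arbitrary choices. -/
theorem levelChar_eq_of_pow_mul_eq {x : ℚ_[p]} {n k : ℕ} {y z : ℤ_[p]}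
    (hy : (p : ℚ_[p]) ^ n * x = y) (hz : (p : ℚ_[p]) ^ k * x = z) :
    levelChar n y = levelChar k z := by
  have h : (p : ℤ_[p]) ^ k * y = (p : ℤ_[p]) ^ n * z := by
    apply PadicInt.ext
    push_cast
    rw [← hy, ← hz]
    ring
  rw [← levelChar_add_mul n k, h, add_comm, levelChar_add_mul]

variable (p) in
/-- The standard character of `ℚ_p`, with kernel `ℤ_p`. -/
def padicChar : ℚ_[p] →+ Additive Circle :=
  AddMonoidHom.mk' (fun x => levelChar (denExp p x) (num x)) fun x y => by
    have h : (p : ℚ_[p]) ^ (denExp p x + denExp p y) * (x + y) =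
        ((p : ℤ_[p]) ^ denExp p y * num x + (p : ℤ_[p]) ^ denExp p x * num y : ℤ_[p]) := by
      push_cast
      rw [← pow_denExp_mul, ← pow_denExp_mul]
      ring
    rw [levelChar_eq_of_pow_mul_eq (pow_denExp_mul (x + y)) h, map_add, levelChar_add_mul,
      add_comm (denExp p x), levelChar_add_mul]

theorem padicChar_eq_levelChar {x : ℚ_[p]} {n : ℕ} {y : ℤ_[p]} (hy : (p : ℚ_[p]) ^ n * x = y) :
    padicChar p x = levelChar n y :=
  levelChar_eq_of_pow_mul_eq (pow_denExp_mul x) hy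

theorem padicChar_eq_zero_iff (x : ℚ_[p]) : padicChar p x = 0 ↔ ∃ y : ℤ_[p], (y : ℚ_[p]) = x := by
  have hp : (p : ℚ_[p]) ≠ 0 := Nat.cast_ne_zero.2 (Fact.out : p.Prime).ne_zero
  rw [padicChar_eq_levelChar (pow_denExp_mul x), levelChar_eq_zero_iff]
  refine exists_congr fun y => ?_
  rw [← mul_right_inj' (pow_ne_zero (denExp p x) hp), pow_denExp_mul]
  constructor
  · intro h
    rw [h]
    push_cast
    rfl
  · intro h
    apply PadicInt.ext
    push_cast
    exact h.symm

theorem padicChar_coe (y : ℤ_[p]) : padicChar p y = 0 := (padicChar_eq_zero_iff _).2 ⟨y, rfl⟩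

/-- Such a `z` is a power `exp (2πi / p ^ n) ^ i`, which is hit by `i / p ^ n`. -/
theorem exists_padicChar_eq {z : Additive Circle} {n : ℕ} (hz : p ^ n • z = 0) :
    ∃ x, padicChar p x = z := by
  have hp : (p : ℚ_[p]) ≠ 0 := Nat.cast_ne_zero.2 (Fact.out : p.Prime).ne_zero
  have hz' : (z.toMul : ℂ) ^ (p ^ n) = 1 := by
    have h : z.toMul ^ (p ^ n) = 1 := congrArg Additive.toMul hz
    exact_mod_cast congrArg (Circle.coeHom) h
  obtain ⟨i, -, hi⟩ := (Complex.isPrimitiveRoot_exp (p ^ n) (NeZero.ne _)).eq_pow_of_pow_eq_one hz'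
  refine ⟨i / (p : ℚ_[p]) ^ n, ?_⟩
  rw [padicChar_eq_levelChar (n := n) (y := i), levelChar_apply,
    map_natCast (PadicInt.toZModPow n)]
  · refine congrArg Additive.ofMul (a₂ := z.toMul) ?_
    ext
    rw [ZMod.toCircle_natCast, ← hi, ← Complex.exp_nat_mul]
    congr 1
    ring
  · push_cast
    field_simp

end PadicCharacter

theorem coeff_mapDomain_eq_sum {R A B : Type*} [Semiring R] [Fintype A] [DecidableEq B]
    (f : A → B) (x : MonoidAlgebra R A) (b : B) :
    (MonoidAlgebra.mapDomain f x).coeff b = ∑ a, if f a = b then x.coeff a else 0 := by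
  classical
  induction x using MonoidAlgebra.induction_linear with
  | zero => simp
  | add x y hx hy =>
    rw [MonoidAlgebra.mapDomain_add, MonoidAlgebra.coeff_add, Finsupp.add_apply, hx, hy,
      ← Finset.sum_add_distrib]
    refine Finset.sum_congr rfl fun a _ => ?_
    split_ifs <;> simp
  | single c r =>
    rw [MonoidAlgebra.mapDomain_single, MonoidAlgebra.coeff_single, Finsupp.single_apply,
      Fintype.sum_eq_single c]
    · simp
    · intro a ha
      simp [Ne.symm ha]

/-- The projection `G/V → G/U` for open subgroups `V ≤ U`. -/
def quotMap {G : Type u} [CommGroup G] [TopologicalSpace G] {V U : OpenSubgroup G} (h : V ≤ U) :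
    G ⧸ V.toSubgroup →* G ⧸ U.toSubgroup :=
  QuotientGroup.map V.toSubgroup U.toSubgroup (MonoidHom.id G) h

/-! ### The projections to `ℤ_p[G/U]` and their kernels. -/

section Projections

variable {p : ℕ} [Fact p.Prime] {G : Type u} [CommGroup G] [TopologicalSpace G]

/-- The projection `ℤ_p⟦G⟧ → ℤ_p[G/U]`. -/
def proj (U : OpenSubgroup G) :
    CompletedGroupAlgebra p G →ₐ[ℤ_[p]] MonoidAlgebra ℤ_[p] (G ⧸ U.toSubgroup) :=
  (Pi.evalAlgHom ℤ_[p] (fun U : OpenSubgroup G => MonoidAlgebra ℤ_[p] (G ⧸ U.toSubgroup)) U).comp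
    (compatibleFamilies p G).val

theorem ext_proj {x y : CompletedGroupAlgebra p G} (h : ∀ U, proj U x = proj U y) : x = y :=
  Subtype.ext (funext h)

theorem groupRingProj_proj {V U : OpenSubgroup G} (h : V ≤ U) (x : CompletedGroupAlgebra p G) :
    groupRingProj p G h (proj V x) = proj U x :=
  x.2 V U h

theorem groupRingProj_apply {V U : OpenSubgroup G} (h : V ≤ U)
    (x : MonoidAlgebra ℤ_[p] (G ⧸ V.toSubgroup)) :
    groupRingProj p G h x = MonoidAlgebra.mapDomain (quotMap h) x := rfl

theorem proj_groupElt (U : OpenSubgroup G) (g : G) :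
    proj U (groupElt p g) = MonoidAlgebra.single (g : G ⧸ U.toSubgroup) 1 := rfl

theorem proj_groupElt_of_mem {U : OpenSubgroup G} {g : G} (hg : g ∈ U) :
    proj U (groupElt p g) = 1 := by
  rw [proj_groupElt, (QuotientGroup.eq_one_iff g).2 hg]
  rfl

theorem proj_surjective (U : OpenSubgroup G) :
    Function.Surjective (proj (p := p) U) := by
  intro x
  induction x using MonoidAlgebra.induction_linear with
  | zero => exact ⟨0, map_zero _⟩
  | add x y hx hy =>
    obtain ⟨a, rfl⟩ := hx
    obtain ⟨b, rfl⟩ := hy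
    exact ⟨a + b, map_add _ _ _⟩
  | single g r =>
    obtain ⟨g, rfl⟩ := QuotientGroup.mk_surjective g
    refine ⟨r • groupElt p g, ?_⟩
    rw [map_smul, proj_groupElt, MonoidAlgebra.smul_single, smul_eq_mul, mul_one]

variable (p) in
/-- The ideal of `ℤ_p⟦G⟧` generated by the elements `u - 1` with `u ∈ U`. -/
def augIdeal (U : OpenSubgroup G) : Ideal (CompletedGroupAlgebra p G) :=
  Ideal.span {x | ∃ u ∈ U, x = groupElt p u - 1}

theorem proj_eq_zero_of_mem_augIdeal {U : OpenSubgroup G} {x : CompletedGroupAlgebra p G}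
    (hx : x ∈ augIdeal p U) : proj U x = 0 := by
  have h : augIdeal p U ≤ RingHom.ker (proj (p := p) U) := by
    refine Ideal.span_le.2 ?_
    rintro _ ⟨u, hu, rfl⟩
    rw [SetLike.mem_coe, RingHom.mem_ker, map_sub, proj_groupElt_of_mem hu, map_one, sub_self]
  exact h hx

theorem augmentationSubmodule_eq_smul_top (M : Type v) [AddCommGroup M]
    [Module (CompletedGroupAlgebra p G) M] (U : OpenSubgroup G) :
    augmentationSubmodule p G M U =
      augIdeal p U • (⊤ : Submodule (CompletedGroupAlgebra p G) M) := by
  apply le_antisymm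
  · refine Submodule.span_le.2 ?_
    rintro _ ⟨u, hu, m, rfl⟩
    have h : groupElt p u • m - m = (groupElt p u - 1) • m := by rw [sub_smul, one_smul]
    rw [h]
    exact Submodule.smul_mem_smul (Ideal.subset_span ⟨u, hu, rfl⟩) trivial
  · refine Submodule.smul_le.2 fun r hr m _ => ?_
    induction hr using Submodule.span_induction generalizing m with
    | mem x hx =>
      obtain ⟨u, hu, rfl⟩ := hx
      rw [sub_smul, one_smul]
      exact Submodule.subset_span ⟨u, hu, m, rfl⟩
    | zero => rw [zero_smul]; exact Submodule.zero_mem _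
    | add x y _ _ hx hy => rw [add_smul]; exact Submodule.add_mem _ (hx m trivial) (hy m trivial)
    | smul a x _ hx => rw [smul_assoc]; exact Submodule.smul_mem _ _ (hx m trivial)

/-- If an ideal contains `u - 1` modulo the kernel of `proj V` for each `u ∈ U`, then it contains
the kernel of `proj U` modulo the kernel of `proj V`. -/
theorem exists_mem_proj_eq {V U : OpenSubgroup G} (h : V ≤ U)
    {I : Ideal (CompletedGroupAlgebra p G)}
    (hI : ∀ u ∈ U, ∃ y ∈ I, proj V y = proj V (groupElt p u - 1))
    {x : CompletedGroupAlgebra p G} (hx : proj U x = 0) : ∃ y ∈ I, proj V y = proj V x := by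
  set J : Ideal (MonoidAlgebra ℤ_[p] (G ⧸ V.toSubgroup)) := I.map (proj V) with hJ
  let F : G ⧸ U.toSubgroup →* MonoidAlgebra ℤ_[p] (G ⧸ V.toSubgroup) ⧸ J :=
    QuotientGroup.lift U.toSubgroup
      (((Ideal.Quotient.mk J).toMonoidHom.comp (proj (p := p) V).toRingHom.toMonoidHom).comp
        (groupElt p))
      fun u hu => by
        obtain ⟨y, hy, hyu⟩ := hI u hu
        change Ideal.Quotient.mk J (proj V (groupElt p u)) = 1
        rw [← sub_eq_zero, ← map_one (Ideal.Quotient.mk J), ← map_sub,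
          Ideal.Quotient.eq_zero_iff_mem,
          ← map_one (proj (p := p) V), ← map_sub, ← hyu]
        exact Ideal.mem_map_of_mem _ hy
  -- Modulo `J` the image of `g` depends only on its class in `G/U`, so reduction modulo `J` factors
  -- through `ℤ_p[G/U]`.
  have hF : (MonoidAlgebra.lift ℤ_[p] _ _ F).comp (groupRingProj p G h) =
      Ideal.Quotient.mkₐ ℤ_[p] J := by
    refine MonoidAlgebra.algHom_ext (fun g => ?_) (Subsingleton.elim _ _)
    obtain ⟨g, rfl⟩ := QuotientGroup.mk_surjective g
    rw [AlgHom.comp_apply, groupRingProj_apply, MonoidAlgebra.mapDomain_single,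
      MonoidAlgebra.lift_single, one_smul]
    rfl
  have hz : Ideal.Quotient.mk J (proj V x) = 0 := by
    have := DFunLike.congr_fun hF (proj V x)
    rw [AlgHom.comp_apply, groupRingProj_proj, hx, map_zero] at this
    exact this.symm
  rw [Ideal.Quotient.eq_zero_iff_mem, hJ,
    Ideal.mem_map_iff_of_surjective (proj (p := p) V) (proj_surjective V)] at hz
  exact hz

end Projections

/-! ### Compactness of `ℤ_p⟦G⟧`; finitely generated ideals are closed. -/

section Compactness

variable {p : ℕ} [Fact p.Prime] {G : Type u} [CommGroup G] [TopologicalSpace G]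

theorem continuous_coeff_proj (U : OpenSubgroup G) (i : G ⧸ U.toSubgroup) :
    Continuous fun x : CompletedGroupAlgebra p G => (proj U x).coeff i :=
  (continuous_apply (⟨U, i⟩ : Σ U : OpenSubgroup G, G ⧸ U.toSubgroup)).comp
    (continuous_induced_dom (f := fun (x : CompletedGroupAlgebra p G)
      (i : Σ U : OpenSubgroup G, G ⧸ U.toSubgroup) => (x.1 i.1).coeff i.2))

variable [IsTopologicalGroup G] [CompactSpace G]

instance quotientFintype (U : OpenSubgroup G) : Fintype (G ⧸ U.toSubgroup) :=
  haveI : Finite (G ⧸ U.toSubgroup) := Subgroup.quotient_finite_of_isOpen U.toSubgroup U.isOpen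
  Fintype.ofFinite _

/-- The coefficients embed the algebra in a product of copies of `ℤ_p`, with image cut out by the
closed compatibility equations. -/
instance : CompactSpace (CompletedGroupAlgebra p G) := by
  classical
  let c : CompletedGroupAlgebra p G → (Σ U : OpenSubgroup G, G ⧸ U.toSubgroup) → ℤ_[p] :=
    fun x i => (x.1 i.1).coeff i.2
  have hc : Topology.IsInducing c := ⟨rfl⟩
  have hr : Set.range c = ⋂ (V : OpenSubgroup G) (U : OpenSubgroup G) (h : V ≤ U)
      (b : G ⧸ U.toSubgroup), {f | (∑ a : G ⧸ V.toSubgroup,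
        if quotMap h a = b
          then f ⟨V, a⟩ else 0) = f ⟨U, b⟩} := by
    ext f
    simp only [Set.mem_iInter, Set.mem_ofPred_eq]
    constructor
    · rintro ⟨x, rfl⟩ V U h b
      refine (coeff_mapDomain_eq_sum (quotMap h) (x.1 V) b).symm.trans ?_
      exact congrArg (fun y => y.coeff b) (x.2 V U h)
    · intro hf
      refine ⟨⟨fun U => .ofCoeff (Finsupp.equivFunOnFinite.symm fun a => f ⟨U, a⟩), ?_⟩, ?_⟩
      · intro V U h
        ext b
        rw [groupRingProj_apply, coeff_mapDomain_eq_sum]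
        exact hf V U h b
      · rfl
  have hcl : IsClosed (Set.range c) := by
    rw [hr]
    refine isClosed_iInter fun V => isClosed_iInter fun U => isClosed_iInter fun h =>
      isClosed_iInter fun b => isClosed_eq (continuous_finsetSum _ fun a _ => ?_)
        (continuous_apply _)
    split_ifs
    · exact continuous_apply _
    · exact continuous_const
  rw [← isCompact_univ_iff, hc.isCompact_iff, Set.image_univ]
  exact hcl.isCompact

theorem continuous_coeff_proj_mul (U : OpenSubgroup G) (y : CompletedGroupAlgebra p G)
    (i : G ⧸ U.toSubgroup) :
    Continuous fun x : CompletedGroupAlgebra p G => (proj U (x * y)).coeff i := by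
  have h : ∀ x : CompletedGroupAlgebra p G, (proj U (x * y)).coeff i =
      ∑ a : G ⧸ U.toSubgroup, (proj U x).coeff a * (proj U y).coeff (a⁻¹ * i) := fun x => by
    rw [map_mul, MonoidAlgebra.coeff_mul_apply_left, Finsupp.sum_fintype _ _ (by simp)]
  simp_rw [h]
  exact continuous_finsetSum _ fun a _ => (continuous_coeff_proj U a).mul continuous_const

/-- Finitely generated ideals of `ℤ_p⟦G⟧` are closed. -/
theorem mem_span_range_of_forall_proj {ι : Type*} [Fintype ι]
    (x : ι → CompletedGroupAlgebra p G) (y : CompletedGroupAlgebra p G)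
    (h : ∀ V : OpenSubgroup G, ∃ z ∈ Ideal.span (Set.range x), proj V z = proj V y) :
    y ∈ Ideal.span (Set.range x) := by
  let S : OpenSubgroup G → Set (ι → CompletedGroupAlgebra p G) := fun V =>
    {c | proj V (∑ i, c i * x i) = proj V y}
  have hcl : ∀ V, IsClosed (S V) := fun V => by
    have : S V = ⋂ b : G ⧸ V.toSubgroup,
        {c | ∑ i, (proj V (c i * x i)).coeff b = (proj V y).coeff b} := by
      ext c
      simp only [S, Set.mem_ofPred_eq, Set.mem_iInter, map_sum]
      rw [← MonoidAlgebra.coeff_inj, DFunLike.ext_iff]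
      simp only [MonoidAlgebra.coeff_sum, Finsupp.finsetSum_apply]
    rw [this]
    exact isClosed_iInter fun b => isClosed_eq (continuous_finsetSum _ fun i _ =>
      (continuous_coeff_proj_mul V (x i) b).comp (continuous_apply i)) continuous_const
  have hdir : Directed (· ⊇ ·) S := fun V V' => by
    have hmono : ∀ {V U : OpenSubgroup G}, V ≤ U → S V ⊆ S U := fun {V U} hVU c hc => by
      change proj U _ = proj U _
      rw [← groupRingProj_proj hVU, ← groupRingProj_proj hVU]
      exact congrArg _ hc
    exact ⟨V ⊓ V', hmono inf_le_left, hmono inf_le_right⟩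
  -- The coefficient vectors that work at a given level form a nonempty compact set, and these sets
  -- decrease with the level; a common point expresses `y` itself.
  obtain ⟨c, hc⟩ := IsCompact.nonempty_iInter_of_directed_nonempty_isCompact_isClosed S hdir
    (fun V => by
      obtain ⟨z, hz, hzy⟩ := h V
      obtain ⟨c, rfl⟩ := Ideal.mem_span_range_iff_exists_fun.1 hz
      exact ⟨c, hzy⟩)
    (fun V => (hcl V).isCompact) hcl
  exact Ideal.mem_span_range_iff_exists_fun.2 ⟨c, ext_proj fun V => Set.mem_iInter.1 hc V⟩

end Compactness

/-! ### The subgroups `p ^ n ℤ_p ^ d` and generators of the augmentation ideals. -/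

section PadicLattice

variable {p : ℕ} [Fact p.Prime] {d : ℕ} {G : Type u} [CommGroup G] [TopologicalSpace G]
variable (e : G ≃ₜ* Multiplicative (Fin d → ℤ_[p]))

/-- The `i`-th coordinate of `G ≅ ℤ_p ^ d`. -/
def coord (i : Fin d) : G →* Multiplicative ℤ_[p] :=
  (AddMonoidHom.toMultiplicative (Pi.evalAddMonoidHom (fun _ : Fin d => ℤ_[p]) i)).comp
    (e : G ≃* Multiplicative (Fin d → ℤ_[p])).toMonoidHom

theorem coord_apply (i : Fin d) (g : G) : (coord e i g).toAdd = (e g).toAdd i := rfl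

theorem continuous_coord (i : Fin d) : Continuous fun g => (coord e i g).toAdd :=
  (continuous_apply i).comp (continuous_toAdd.comp e.continuous)

/-- The subgroup of `G ≅ ℤ_p ^ d` that corresponds to `p ^ n ℤ_p ^ d`. -/
def powSubgroup (n : ℕ) : OpenSubgroup G where
  carrier := {g | ∀ i, ‖(coord e i g).toAdd‖ ≤ (p : ℝ) ^ (-(n : ℤ))}
  mul_mem' {a b} ha hb i := by
    rw [map_mul, toAdd_mul]
    exact (PadicInt.nonarchimedean _ _).trans (max_le (ha i) (hb i))
  one_mem' i := by
    rw [map_one, toAdd_one, norm_zero]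
    positivity
  inv_mem' {a} ha i := by
    rw [map_inv, toAdd_inv, norm_neg]
    exact ha i
  isOpen' := by
    have hp : (p : ℝ) ^ (-(n : ℤ)) ≠ 0 :=
      zpow_ne_zero _ (Nat.cast_ne_zero.2 (Fact.out : p.Prime).ne_zero)
    have h : {g | ∀ i, ‖(coord e i g).toAdd‖ ≤ (p : ℝ) ^ (-(n : ℤ))} =
        ⋂ i, (fun g => (coord e i g).toAdd) ⁻¹' Metric.closedBall 0 ((p : ℝ) ^ (-(n : ℤ))) := by
      ext g
      simp
    refine (congrArg IsOpen h).mpr (isOpen_iInter_of_finite fun i => ?_)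
    exact (IsUltrametricDist.isOpen_closedBall _ hp).preimage (continuous_coord e i)

theorem mem_powSubgroup {n : ℕ} {g : G} :
    g ∈ powSubgroup e n ↔ ∀ i, (p : ℤ_[p]) ^ n ∣ (coord e i g).toAdd := by
  refine forall_congr' fun i => ?_
  rw [PadicInt.norm_le_pow_iff_mem_span_pow, Ideal.mem_span_singleton]

theorem powSubgroup_zero : powSubgroup e 0 = ⊤ :=
  top_le_iff.1 fun _ _ => (mem_powSubgroup e).2 fun i => by rw [pow_zero]; exact one_dvd _

theorem exists_powSubgroup_le (U : OpenSubgroup G) : ∃ n, powSubgroup e n ≤ U := by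
  have h : (fun x : Fin d → ℤ_[p] => e.symm (Multiplicative.ofAdd x)) ⁻¹' (U : Set G) ∈
      nhds (0 : Fin d → ℤ_[p]) := by
    refine (e.symm.continuous.comp continuous_ofAdd).continuousAt.preimage_mem_nhds ?_
    refine U.isOpen.mem_nhds ?_
    change e.symm 1 ∈ U
    rw [map_one]
    exact U.one_mem
  obtain ⟨ε, hε, hU⟩ := Metric.mem_nhds_iff.1 h
  have hp : (1 : ℝ) < p := by exact_mod_cast (Fact.out : p.Prime).one_lt
  obtain ⟨n, hn⟩ := exists_pow_lt_of_lt_one hε (inv_lt_one_of_one_lt₀ hp)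
  refine ⟨n, fun g hg => ?_⟩
  have h2 : (e g).toAdd ∈ Metric.ball (0 : Fin d → ℤ_[p]) ε := by
    rw [mem_ball_zero_iff, pi_norm_lt_iff hε]
    intro i
    refine lt_of_le_of_lt (hg i) ?_
    rwa [zpow_neg, zpow_natCast, ← inv_pow]
  have h3 := hU h2
  rw [Set.mem_preimage, ofAdd_toAdd] at h3
  rwa [← e.symm_apply_apply g]

/-- The standard topological generators of `G ≅ ℤ_p ^ d`. -/
def topGen (i : Fin d) : G := e.symm (Multiplicative.ofAdd (Pi.single i 1))

theorem coord_topGen (i j : Fin d) :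
    (coord e j (topGen e i)).toAdd = (Pi.single i 1 : Fin d → ℤ_[p]) j := by
  rw [coord_apply, topGen, ContinuousMulEquiv.apply_symm_apply, toAdd_ofAdd]

theorem coord_prod_topGen (a : Fin d → ℕ) (j : Fin d) :
    (coord e j (∏ i, topGen e i ^ a i)).toAdd = a j := by
  rw [map_prod, toAdd_prod, Finset.sum_eq_single j]
  · rw [map_pow, toAdd_pow, coord_topGen, Pi.single_eq_same, nsmul_eq_mul, mul_one]
  · intro i _ hi
    rw [map_pow, toAdd_pow, coord_topGen, Pi.single_eq_of_ne hi.symm, smul_zero]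
  · simp

theorem topGen_pow_mem (i : Fin d) (n : ℕ) : topGen e i ^ p ^ n ∈ powSubgroup e n := by
  refine (mem_powSubgroup e).2 fun j => ?_
  rw [map_pow, toAdd_pow, nsmul_eq_mul, Nat.cast_pow]
  exact dvd_mul_right _ _

/-- The elements `γ_i ^ (p ^ n) - 1`. -/
def genSubOne (n : ℕ) (i : Fin d) : CompletedGroupAlgebra p G :=
  groupElt p (topGen e i ^ p ^ n) - 1

/-- Modulo `V`, the element `u` agrees with a product of integer powers of the `γ_i ^ (p ^ n)`, each
of which is `1` modulo the ideal. -/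
theorem exists_proj_eq_groupElt_sub_one (n : ℕ) (V : OpenSubgroup G) {u : G}
    (hu : u ∈ powSubgroup e n) :
    ∃ y ∈ Ideal.span (Set.range (genSubOne e n)), proj V y = proj V (groupElt p u - 1) := by
  obtain ⟨m, hm⟩ := exists_powSubgroup_le e V
  choose v hv using (mem_powSubgroup e).1 hu
  -- The `i`-th coordinate of `u` is `p ^ n * v i`; approximating `v i` modulo `p ^ m` suffices,
  -- since `powSubgroup e m ≤ V`.
  set a : Fin d → ℕ := fun i => (v i).appr m with ha
  set g : G := ∏ i, topGen e i ^ (p ^ n * a i) with hg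
  have hgu : g⁻¹ * u ∈ V := by
    refine hm ((mem_powSubgroup e).2 fun i => ?_)
    rw [map_mul, map_inv, toAdd_mul, toAdd_inv, coord_prod_topGen, hv, neg_add_eq_sub, Nat.cast_mul,
      Nat.cast_pow, ← mul_sub]
    exact (Ideal.mem_span_singleton.1 (PadicInt.appr_spec m (v i))).mul_left _
  refine ⟨groupElt p g - 1, ?_, ?_⟩
  · rw [← Ideal.Quotient.eq_zero_iff_mem, map_sub, map_one, sub_eq_zero, hg, map_prod, map_prod]
    refine Finset.prod_eq_one fun i _ => ?_
    have : Ideal.Quotient.mk (Ideal.span (Set.range (genSubOne e n)))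
        (groupElt p (topGen e i ^ p ^ n)) = 1 := by
      rw [← sub_eq_zero, ← map_one (Ideal.Quotient.mk _), ← map_sub,
        Ideal.Quotient.eq_zero_iff_mem]
      exact Ideal.subset_span ⟨i, rfl⟩
    rw [pow_mul, map_pow, map_pow, this, one_pow]
  · rw [map_sub, map_sub, proj_groupElt, proj_groupElt, QuotientGroup.eq.2 hgu]

variable [IsTopologicalGroup G] [CompactSpace G]

theorem mem_span_genSubOne {n : ℕ} {x : CompletedGroupAlgebra p G}
    (hx : proj (powSubgroup e n) x = 0) : x ∈ Ideal.span (Set.range (genSubOne e n)) := by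
  refine mem_span_range_of_forall_proj _ _ fun V => ?_
  have h0 : proj (powSubgroup e n) (x : CompletedGroupAlgebra p G) = 0 := hx
  obtain ⟨y, hy, hyx⟩ := exists_mem_proj_eq (V := V ⊓ powSubgroup e n) inf_le_right
    (fun u hu => exists_proj_eq_groupElt_sub_one e n _ hu) h0
  refine ⟨y, hy, ?_⟩
  rw [← groupRingProj_proj (inf_le_left : V ⊓ powSubgroup e n ≤ V), hyx, groupRingProj_proj]

theorem augIdeal_top_le : augIdeal p (⊤ : OpenSubgroup G) ≤
    Ideal.span (Set.range (genSubOne e 0)) :=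
  fun x hx => mem_span_genSubOne e <| by
    rw [powSubgroup_zero]
    exact proj_eq_zero_of_mem_augIdeal hx

include e in
/-- The kernel of `ℤ_p⟦G⟧ → ℤ_p[G/U]` is generated by the elements `u - 1` with `u ∈ U`. -/
theorem mem_augIdeal_iff {U : OpenSubgroup G} {x : CompletedGroupAlgebra p G} :
    x ∈ augIdeal p U ↔ proj U x = 0 := by
  refine ⟨proj_eq_zero_of_mem_augIdeal, fun hx => ?_⟩
  obtain ⟨n, hn⟩ := exists_powSubgroup_le e U
  obtain ⟨y, hy, hyx⟩ := exists_mem_proj_eq hn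
    (I := augIdeal p U)
    (fun u hu => ⟨groupElt p u - 1, Ideal.subset_span ⟨u, hu, rfl⟩, rfl⟩) hx
  -- The difference dies in `ℤ_p[G / powSubgroup e n]`, so it lies in the ideal of the `γ_i ^ (p ^
  -- n) - 1`, and `γ_i ^ (p ^ n) ∈ U`.
  have h : x - y ∈ augIdeal p U := by
    refine Ideal.span_le.2 ?_ (mem_span_genSubOne e (n := n) (by rw [map_sub, hyx, sub_self]))
    rintro _ ⟨i, rfl⟩
    exact Ideal.subset_span ⟨_, hn (topGen_pow_mem e i n), rfl⟩
  rw [← sub_add_cancel x y]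
  exact Ideal.add_mem _ h hy

end PadicLattice

/-! ### Topological nilpotence and Nakayama's lemma for compact modules. -/

section Nakayama

variable {p : ℕ} [Fact p.Prime] {d : ℕ} {G : Type u} [CommGroup G] [TopologicalSpace G]
variable (e : G ≃ₜ* Multiplicative (Fin d → ℤ_[p]))

theorem norm_coeff_natCast_mul_le {A : Type*} [Group A] (k : ℕ)
    (x : MonoidAlgebra ℤ_[p] A) (a : A) :
    ‖((p : MonoidAlgebra ℤ_[p] A) ^ k * x).coeff a‖ ≤ ((p : ℝ)⁻¹) ^ k := by
  rw [← Nat.cast_pow, ← nsmul_eq_mul, ← Nat.cast_smul_eq_nsmul ℤ_[p],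
    MonoidAlgebra.coeff_smul_apply,
    smul_eq_mul, norm_mul, Nat.cast_pow, norm_pow, PadicInt.norm_p]
  exact mul_le_of_le_one_right (by positivity) (PadicInt.norm_le_one _)

/-- At each finite level some `p`-power of `γ_i - 1` is divisible by `p`, so its powers tend to `0`
`p`-adically. -/
theorem tendsto_genSubOne_pow (i : Fin d) :
    Filter.Tendsto (fun k => genSubOne e 0 i ^ k) Filter.atTop (nhds 0) := by
  rw [nhds_induced, Filter.tendsto_comap_iff, tendsto_pi_nhds]
  rintro ⟨U, a⟩
  change Filter.Tendsto (fun k => (proj U (genSubOne e 0 i ^ k)).coeff a) Filter.atTop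
    (nhds ((proj U (0 : CompletedGroupAlgebra p G)).coeff a))
  rw [map_zero, MonoidAlgebra.coeff_zero, Finsupp.zero_apply]
  obtain ⟨n, hn⟩ := exists_powSubgroup_le e U
  have hpp : p.Prime := Fact.out
  -- With `t` the image of `γ_i - 1`, one has `(t + 1) ^ p ^ n = 1`, whereas `(t + 1) ^ p ^ n` is `t
  -- ^ p ^ n + 1` modulo `p`.
  obtain ⟨r, hr⟩ : ∃ r, proj U (genSubOne e 0 i) ^ p ^ n = p * r := by
    obtain ⟨r, hr⟩ := exists_add_pow_prime_pow_eq hpp (proj U (genSubOne e 0 i)) 1 n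
    have h1 : (proj U (genSubOne e 0 i) + 1) ^ p ^ n = 1 := by
      rw [← map_one (proj (p := p) U), ← map_add, genSubOne, sub_add_cancel, pow_zero, pow_one,
        ← map_pow, ← map_pow, proj_groupElt_of_mem (hn (topGen_pow_mem e i n)), map_one]
    rw [h1, one_pow] at hr
    exact ⟨-(proj U (genSubOne e 0 i) * 1 * r), by linear_combination -hr⟩
  have hp1 : (p : ℝ)⁻¹ < 1 := inv_lt_one_of_one_lt₀ (by exact_mod_cast hpp.one_lt)
  have hb : ∀ k, ‖(proj U (genSubOne e 0 i ^ k)).coeff a‖ ≤ ((p : ℝ)⁻¹) ^ (k / p ^ n) := fun k => by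
    have : proj U (genSubOne e 0 i ^ k) =
        (p : MonoidAlgebra ℤ_[p] (G ⧸ U.toSubgroup)) ^ (k / p ^ n) *
        (r ^ (k / p ^ n) * proj U (genSubOne e 0 i) ^ (k % p ^ n)) := by
      rw [← mul_assoc, ← mul_pow, ← hr, ← pow_mul, ← pow_add, Nat.div_add_mod, map_pow]
    rw [this]
    exact norm_coeff_natCast_mul_le _ _ _
  refine squeeze_zero_norm hb ?_
  exact (tendsto_pow_atTop_nhds_zero_of_lt_one (by positivity) hp1).comp
    (Nat.tendsto_div_const_atTop (pow_ne_zero n hpp.ne_zero))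

theorem isCompact_sup {R M : Type*} [Ring R] [AddCommGroup M] [Module R M]
    [TopologicalSpace M] [ContinuousAdd M] {N N' : Submodule R M}
    (hN : IsCompact (N : Set M)) (hN' : IsCompact (N' : Set M)) :
    IsCompact ((N ⊔ N' : Submodule R M) : Set M) := by
  rw [Submodule.coe_sup]
  exact hN.add hN'

variable {R : Type*} [CommRing R] [TopologicalSpace R] {M : Type*} [AddCommGroup M] [Module R M]
  [TopologicalSpace M] [CompactSpace M] [IsTopologicalAddGroup M] [ContinuousSMul R M]

-- Iteration gives `M = N + x ^ k M` for all `k`. As `M` is compact, `x ^ k` tends to `0` uniformly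
-- on `M`, so every `m` is a limit of elements of the closed submodule `N`.
open Pointwise in
theorem eq_top_of_isClosed_of_sup_smul_eq_top {x : R}
    (hx : Filter.Tendsto (fun k => x ^ k) Filter.atTop (nhds 0)) {N : Submodule R M}
    (hN : IsClosed (N : Set M)) (h : N ⊔ x • (⊤ : Submodule R M) = ⊤) : N = ⊤ := by
  have hk : ∀ (k : ℕ) (m : M), ∃ m' : M, m - x ^ k • m' ∈ N := fun k => by
    induction k with
    | zero => exact fun m => ⟨m, by rw [pow_zero, one_smul, sub_self]; exact N.zero_mem⟩
    | succ k ih =>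
      intro m
      obtain ⟨m', hm'⟩ := ih m
      obtain ⟨n, hn, y, hy, hny⟩ := Submodule.mem_sup.1 (h.ge (Submodule.mem_top (x := m')))
      obtain ⟨m'', -, rfl⟩ := Submodule.mem_smul_pointwise_iff_exists _ _ _ |>.1 hy
      refine ⟨m'', ?_⟩
      have : m - x ^ (k + 1) • m'' = (m - x ^ k • m') + x ^ k • n := by
        rw [← hny, smul_add, pow_succ, mul_smul]
        abel
      rw [this]
      exact N.add_mem hm' (N.smul_mem _ hn)
  refine eq_top_iff.2 fun m _ => ?_
  choose c hc using fun k => hk k m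
  have hlim : Filter.Tendsto (fun k => x ^ k • c k) Filter.atTop (nhds 0) := by
    rw [(nhds_basis_opens (0 : M)).tendsto_right_iff]
    rintro W ⟨h0, hW⟩
    -- The `c k` vary with `k`; the tube lemma provides a neighbourhood of `0 ∈ R` that sends all of
    -- `M` into `W`.
    obtain ⟨O, O', hO, -, h0O, hO', hOW⟩ := generalized_tube_lemma
      (isCompact_singleton (x := (0 : R)))
      (isCompact_univ (X := M)) (hW.preimage (continuous_smul (M := R) (X := M))) (by
        rintro ⟨r, y⟩ ⟨hr, -⟩
        obtain rfl : r = 0 := hr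
        simpa using h0)
    filter_upwards [hx (hO.mem_nhds (h0O rfl))] with k hk
    exact hOW (show (x ^ k, c k) ∈ O ×ˢ O' from ⟨hk, hO' trivial⟩)
  have := hN.mem_of_tendsto (tendsto_const_nhds.sub hlim) (Filter.Eventually.of_forall hc)
  rwa [sub_zero] at this

-- The `x i` are removed one at a time. `N` is taken compact rather than closed so that its sums
-- with the `x i • ⊤` remain closed.
open Pointwise in
theorem eq_top_of_isCompact_of_sup_iSup_smul_eq_top [T2Space M] {ι : Type*} (x : ι → R)
    (hx : ∀ i, Filter.Tendsto (fun k => x i ^ k) Filter.atTop (nhds 0)) (s : Finset ι)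
    {N : Submodule R M} (hN : IsCompact (N : Set M))
    (h : N ⊔ s.sup (fun i => x i • (⊤ : Submodule R M)) = ⊤) : N = ⊤ := by
  classical
  have hc : ∀ i, IsCompact ((x i • (⊤ : Submodule R M) : Submodule R M) : Set M) := fun i => by
    rw [Submodule.coe_pointwise_smul]
    exact isCompact_univ.image (continuous_const_smul (x i))
  induction s using Finset.induction_on with
  | empty => simpa using h
  | insert i s hi ih =>
    refine ih ?_
    refine eq_top_of_isClosed_of_sup_smul_eq_top (hx i)
      (IsCompact.isClosed (isCompact_sup hN ?_)) ?_
    · refine Finset.sup_induction (p := fun K : Submodule R M => IsCompact (K : Set M)) ?_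
        (fun _ ha _ hb => isCompact_sup ha hb) fun j _ => hc j
      simp
    · rw [Finset.sup_insert] at h
      rw [sup_assoc, sup_comm (s.sup _), h]

end Nakayama

/-! ### Compact modules with finite `M_G` are finitely generated. -/

section FiniteGeneration

variable {p : ℕ} [Fact p.Prime] {d : ℕ} {G : Type u} [CommGroup G] [TopologicalSpace G]
variable [IsTopologicalGroup G] [CompactSpace G] (e : G ≃ₜ* Multiplicative (Fin d → ℤ_[p]))
variable {M : Type v} [AddCommGroup M] [Module (CompletedGroupAlgebra p G) M]

-- Lifts of the elements of `M_G` span a compact submodule, which together with the `(γ_i - 1) M`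
-- exhausts `M`; Nakayama applies.
open Pointwise in
include e in
theorem IsCompactModule.finite (hM : IsCompactModule p G M)
    (hfin : Finite (Coinv p G M ⊤)) : Module.Finite (CompletedGroupAlgebra p G) M := by
  obtain ⟨_, _, _, _, _⟩ := hM
  classical
  have := Fintype.ofFinite (Coinv p G M ⊤)
  let c : Coinv p G M ⊤ → M := fun x => (Submodule.Quotient.mk_surjective _ x).choose
  have hc : ∀ x, Submodule.Quotient.mk (c x) = x :=
    fun x => (Submodule.Quotient.mk_surjective _ x).choose_spec
  have hN : IsCompact
      (Submodule.span (CompletedGroupAlgebra p G) (Set.range c) : Set M) := by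
    have h : (Submodule.span (CompletedGroupAlgebra p G) (Set.range c) : Set M) =
        Set.range fun a : Coinv p G M ⊤ → CompletedGroupAlgebra p G => ∑ x, a x • c x := by
      ext m
      exact Submodule.mem_span_range_iff_exists_fun _
    rw [h]
    exact isCompact_range (continuous_finsetSum _ fun x _ =>
      (continuous_apply x).smul continuous_const)
  refine ⟨⟨Finset.univ.image c, ?_⟩⟩
  rw [Finset.coe_image, Finset.coe_univ, Set.image_univ]
  refine eq_top_of_isCompact_of_sup_iSup_smul_eq_top (genSubOne e 0) (tendsto_genSubOne_pow e)
    Finset.univ hN (eq_top_iff.2 fun m _ => ?_)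
  have hle : augmentationSubmodule p G M ⊤ ≤
      Finset.univ.sup fun i => genSubOne e 0 i • (⊤ : Submodule (CompletedGroupAlgebra p G) M) := by
    rw [augmentationSubmodule_eq_smul_top]
    refine (Submodule.smul_mono_left (augIdeal_top_le e)).trans
      (Submodule.smul_le.2 fun r hr m _ => ?_)
    obtain ⟨a, rfl⟩ := Ideal.mem_span_range_iff_exists_fun.1 hr
    rw [Finset.sum_smul]
    refine Submodule.sum_mem _ fun i _ => ?_
    rw [mul_smul]
    refine Submodule.smul_mem _ _ (Finset.le_sup (f := fun i => genSubOne e 0 i •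
      (⊤ : Submodule (CompletedGroupAlgebra p G) M)) (Finset.mem_univ i) ?_)
    exact Submodule.smul_mem_pointwise_smul _ _ _ trivial
  have hm := hc (Submodule.Quotient.mk m)
  rw [eq_comm, Submodule.Quotient.eq] at hm
  rw [← add_sub_cancel (c (Submodule.Quotient.mk m)) m]
  exact Submodule.add_mem_sup (Submodule.subset_span ⟨_, rfl⟩) (hle hm)

end FiniteGeneration

/-! ### Homological algebra: vanishing of `Ext¹` and dimension shifting. -/

section ExtOne

open Abelian

variable {R : Type u} [CommRing R]

/-- If every linear map from the kernel of a surjection `F → M` to `B` extends to `F`, then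
`Ext¹(M, B)` vanishes. -/
theorem ext_one_eq_zero_of_extension (M B : Type u) [AddCommGroup M] [Module R M] [AddCommGroup B]
    [Module R B]
    (h : ∀ (F : Type u) [AddCommGroup F] [Module R F] (π : F →ₗ[R] M)
      (φ : LinearMap.ker π →ₗ[R] B), ∃ ψ : F →ₗ[R] B, ψ ∘ₗ (LinearMap.ker π).subtype = φ)
    (x : Ext.{u} (ModuleCat.of R M) (ModuleCat.of R B) 1) : x = 0 := by
  let π : (M →₀ R) →ₗ[R] M := Finsupp.linearCombination R id
  have hπ : Function.Surjective π := Finsupp.linearCombination_id_surjective R M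
  let S : ShortComplex (ModuleCat.{u} R) := LinearMap.shortComplexKer π
  have hS : S.ShortExact := LinearMap.shortExact_shortComplexKer hπ
  have hP : Projective S.X₂ :=
    ModuleCat.projective_of_free (Finsupp.basisSingleOne (R := R) (ι := M))
  -- The free module has no `Ext¹`, so `x` is the connecting image of a map on the kernel; that map
  -- extends to the free module, so its connecting image is zero.
  obtain ⟨x₁, rfl⟩ := Ext.contravariant_sequence_exact₃ hS (ModuleCat.of R B) x
    (Ext.eq_zero_of_projective (P := S.X₂) _) (n₀ := 0) rfl
  obtain ⟨f, rfl⟩ := (Ext.mk₀_bijective _ _).2 x₁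
  obtain ⟨ψ, hψ⟩ := h _ π f.hom
  have hf : f = S.f ≫ ModuleCat.ofHom ψ := by
    ext y
    exact (DFunLike.congr_fun hψ y).symm
  rw [hf, ← Ext.mk₀_comp_mk₀, ← Ext.comp_assoc _ _ _ (add_zero 1) (add_zero 0) rfl,
    ShortComplex.ShortExact.extClass_comp, Ext.zero_comp]

/-- Dimension shifting along `0 → A → B → C → 0` when `Hom(M, B)` and `Ext¹(M, B)` vanish. -/
theorem nonempty_linearEquiv_ext_one (M A B C : Type u) [AddCommGroup M] [Module R M]
    [AddCommGroup A] [Module R A] [AddCommGroup B] [Module R B] [AddCommGroup C] [Module R C]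
    (f : A →ₗ[R] B) (g : B →ₗ[R] C) (hf : Function.Injective f) (hg : Function.Surjective g)
    (hfg : Function.Exact f g) (h₀ : ∀ φ : M →ₗ[R] B, φ = 0)
    (h₁ : ∀ x : Ext.{u} (ModuleCat.of R M) (ModuleCat.of R B) 1, x = 0) :
    Nonempty ((M →ₗ[R] C) ≃ₗ[R] Ext.{u} (ModuleCat.of R M) (ModuleCat.of R A) 1) := by
  let S : ShortComplex (ModuleCat.{u} R) :=
    ShortComplex.mk (ModuleCat.ofHom f) (ModuleCat.ofHom g)
      (by ext x; exact hfg.apply_apply_eq_zero x)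
  have hS : S.ShortExact := ModuleCat.shortComplex_shortExact S hfg hf hg
  let δ : Ext.{u} (ModuleCat.of R M) S.X₃ 0 →ₗ[R] Ext.{u} (ModuleCat.of R M) S.X₁ 1 :=
    Ext.postcompOfLinear hS.extClass R (ModuleCat.of R M) (zero_add 1)
  have hδ : Function.Bijective δ := by
    constructor
    · refine (injective_iff_map_eq_zero δ).2 fun x hx => ?_
      obtain ⟨y, rfl⟩ := Ext.covariant_sequence_exact₃ _ hS x (zero_add 1) hx
      obtain ⟨φ, rfl⟩ := (Ext.mk₀_bijective _ _).2 y
      have hφ : φ = 0 := ModuleCat.hom_ext (h₀ φ.hom)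
      rw [hφ, Ext.mk₀_zero, Ext.zero_comp]
    · exact fun x => Ext.covariant_sequence_exact₁ _ hS x (h₁ _) (zero_add 1)
  exact ⟨ModuleCat.homLinearEquiv.symm.trans
    ((Ext.linearEquiv₀ (R := R)).symm.trans (LinearEquiv.ofBijective δ hδ))⟩

end ExtOne

/-! ### Annihilators of `M` that become powers of `p` at a finite level. -/

section Annihilator

variable {p : ℕ} [Fact p.Prime] {G : Type u} [CommGroup G] [TopologicalSpace G]

/-- The prime-to-`p` part of the order of `N` is a unit in `ℤ_p`, so it can be cancelled. -/
theorem exists_pow_smul_eq_zero (N : Type v) [AddCommGroup N] [Module (CompletedGroupAlgebra p G) N]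
    [Finite N] : ∃ k : ℕ, ∀ x : N, p ^ k • x = 0 := by
  obtain ⟨k, b, hb, hq⟩ := Nat.exists_eq_pow_mul_and_not_dvd (Nat.card_pos (α := N)).ne' p
    (Fact.out : p.Prime).ne_one
  refine ⟨k, fun x => ?_⟩
  have hu : IsUnit ((b : ℤ_[p])) := by
    rw [PadicInt.isUnit_iff, PadicInt.norm_natCast_eq_one_iff]
    exact ((Fact.out : p.Prime).coprime_iff_not_dvd.2 hb)
  have hu' : IsUnit (b : CompletedGroupAlgebra p G) := by
    have := hu.map (algebraMap ℤ_[p] (CompletedGroupAlgebra p G))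
    rwa [map_natCast] at this
  rw [← hu'.smul_eq_zero, Nat.cast_smul_eq_nsmul, ← mul_smul, mul_comm, ← hq]
  exact card_nsmul_eq_zero'

/-- If `M` is finitely generated and `M_U` is finite, then some element of the annihilator of `M`
maps to a power of `p` in `ℤ_p[G/U]`. -/
theorem exists_annihilator_proj_eq_pow (M : Type v) [AddCommGroup M]
    [Module (CompletedGroupAlgebra p G) M] [Module.Finite (CompletedGroupAlgebra p G) M]
    (U : OpenSubgroup G) [Finite (Coinv p G M U)] :
    ∃ (s : CompletedGroupAlgebra p G) (n : ℕ), (∀ x : M, s • x = 0) ∧ proj U s = p ^ n := by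
  obtain ⟨k, hk⟩ := exists_pow_smul_eq_zero (p := p) (G := G) (Coinv p G M U)
  set c : CompletedGroupAlgebra p G := p ^ k with hc
  -- Cayley–Hamilton for multiplication by `p ^ k`, which maps `M` into `I_U M` because `p ^ k`
  -- kills `M_U`.
  obtain ⟨P, hP, -, hcoeff, hzero⟩ :=
    LinearMap.exists_monic_and_natDegree_eq_and_coeff_mem_pow_and_aeval_eq_zero
      (CompletedGroupAlgebra p G)
      (algebraMap _ (Module.End (CompletedGroupAlgebra p G) M) c) (augIdeal p U) (by
        rw [← augmentationSubmodule_eq_smul_top]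
        rintro _ ⟨x, rfl⟩
        rw [Module.algebraMap_end_apply, ← Submodule.Quotient.mk_eq_zero,
          Submodule.Quotient.mk_smul,
          hc, ← Nat.cast_pow, Nat.cast_smul_eq_nsmul]
        exact hk _)
  refine ⟨P.eval c, k * P.natDegree, fun x => ?_, ?_⟩
  · rw [Polynomial.aeval_algebraMap_apply_eq_algebraMap_eval] at hzero
    exact DFunLike.congr_fun hzero x
  · rw [Polynomial.eval_eq_sum_range, Finset.sum_range_succ, hP.coeff_natDegree, one_mul, map_add,
      map_sum, Finset.sum_eq_zero, zero_add, map_pow, hc, map_pow, map_natCast, pow_mul]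
    intro i hi
    -- A non-leading coefficient lies in a positive power of `I_U`, so only the leading term `c ^
    -- P.natDegree` survives in `ℤ_p[G/U]`.
    rw [map_mul, proj_eq_zero_of_mem_augIdeal, zero_mul]
    exact Ideal.pow_le_self (Nat.sub_ne_zero_of_lt (Finset.mem_range.1 hi)) (hcoeff i)

end Annihilator

/-! ### The limit `Q` of the `ℚ_p[G/U]`, and vanishing of `Hom(M, Q)` and of the extension
obstruction. -/

section Rational

variable (p : ℕ) [Fact p.Prime] (G : Type u) [CommGroup G] [TopologicalSpace G]

/-- The inverse limit of the group algebras `ℚ_p[G/U]`. -/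
def ratFamilies : Subring (∀ U : OpenSubgroup G, MonoidAlgebra ℚ_[p] (G ⧸ U.toSubgroup)) where
  carrier := {x | ∀ (V U : OpenSubgroup G) (h : V ≤ U),
    MonoidAlgebra.mapDomainRingHom ℚ_[p] (quotMap h) (x V) = x U}
  mul_mem' := fun hx hy V U h => by rw [Pi.mul_apply, map_mul, hx V U h, hy V U h, Pi.mul_apply]
  one_mem' := fun V U h => map_one _
  add_mem' := fun hx hy V U h => by rw [Pi.add_apply, map_add, hx V U h, hy V U h, Pi.add_apply]
  zero_mem' := fun V U h => map_zero _
  neg_mem' := fun hx V U h => by rw [Pi.neg_apply, map_neg, hx V U h, Pi.neg_apply]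

/-- The inverse limit of the group algebras `ℚ_p[G/U]`. -/
def RatGroupAlgebra : Type u := ratFamilies p G

instance : CommRing (RatGroupAlgebra p G) := inferInstanceAs (CommRing (ratFamilies p G))

variable {p G}

/-- The projection `lim ℚ_p[G/U] → ℚ_p[G/U]`. -/
def ratProj (U : OpenSubgroup G) :
    RatGroupAlgebra p G →+* MonoidAlgebra ℚ_[p] (G ⧸ U.toSubgroup) :=
  (Pi.evalRingHom (fun U : OpenSubgroup G => MonoidAlgebra ℚ_[p] (G ⧸ U.toSubgroup)) U).comp
    (ratFamilies p G).subtype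

theorem ext_ratProj {x y : RatGroupAlgebra p G} (h : ∀ U, ratProj U x = ratProj U y) : x = y :=
  Subtype.ext (funext h)

/-- The element of `lim ℚ_p[G/U]` with given components. -/
def ratMk (f : ∀ U : OpenSubgroup G, MonoidAlgebra ℚ_[p] (G ⧸ U.toSubgroup))
    (hf : ∀ (V U : OpenSubgroup G) (h : V ≤ U),
      MonoidAlgebra.mapDomain (quotMap h) (f V) = f U) : RatGroupAlgebra p G :=
  ⟨f, hf⟩

theorem mapDomain_ratProj {V U : OpenSubgroup G} (h : V ≤ U) (x : RatGroupAlgebra p G) :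
    MonoidAlgebra.mapDomain (quotMap h) (ratProj V x) = ratProj U x :=
  x.2 V U h

variable (p) in
/-- The inclusion `ℤ_p[A] → ℚ_p[A]`. -/
def toRat (A : Type*) [Group A] : MonoidAlgebra ℤ_[p] A →+* MonoidAlgebra ℚ_[p] A :=
  MonoidAlgebra.mapRingHom A PadicInt.Coe.ringHom

theorem coeff_toRat {A : Type*} [Group A] (x : MonoidAlgebra ℤ_[p] A) (a : A) :
    (toRat p A x).coeff a = x.coeff a := MonoidAlgebra.coeff_mapRingHom _ _ _

theorem toRat_single {A : Type*} [Group A] (a : A) (r : ℤ_[p]) :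
    toRat p A (MonoidAlgebra.single a r) = MonoidAlgebra.single a (r : ℚ_[p]) :=
  MonoidAlgebra.mapRingHom_single _ _ _

theorem toRat_mapDomain {A B : Type*} [Group A] [Group B] (f : A →* B) (x : MonoidAlgebra ℤ_[p] A) :
    toRat p B (MonoidAlgebra.mapDomain f x) = MonoidAlgebra.mapDomain f (toRat p A x) :=
  DFunLike.congr_fun
    (MonoidAlgebra.mapRingHom_comp_mapDomainRingHom (PadicInt.Coe.ringHom (p := p)) f) x

variable (p G) in
/-- The inclusion `ℤ_p⟦G⟧ → lim ℚ_p[G/U]`. -/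
def ratInclusion : CompletedGroupAlgebra p G →+* RatGroupAlgebra p G :=
  RingHom.codRestrict (RingHom.pi fun U : OpenSubgroup G =>
    (toRat p (G ⧸ U.toSubgroup)).comp (proj (p := p) U).toRingHom) (ratFamilies p G)
    fun x V U h => by
      change MonoidAlgebra.mapDomain (quotMap h) (toRat p _ (proj V x)) = toRat p _ (proj U x)
      rw [← toRat_mapDomain, ← groupRingProj_apply, groupRingProj_proj]

instance : Algebra (CompletedGroupAlgebra p G) (RatGroupAlgebra p G) := (ratInclusion p G).toAlgebra

theorem ratProj_algebraMap (U : OpenSubgroup G) (x : CompletedGroupAlgebra p G) :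
    ratProj U (algebraMap _ (RatGroupAlgebra p G) x) = toRat p _ (proj U x) := rfl

theorem ratProj_smul (U : OpenSubgroup G) (x : CompletedGroupAlgebra p G)
    (y : RatGroupAlgebra p G) : ratProj U (x • y) = toRat p _ (proj U x) * ratProj U y := by
  rw [Algebra.smul_def, map_mul, ratProj_algebraMap]

theorem coeff_ratProj_groupElt_smul (U : OpenSubgroup G) (g : G) (y : RatGroupAlgebra p G)
    (a : G ⧸ U.toSubgroup) :
    (ratProj U (groupElt p g • y)).coeff a =
      (ratProj U y).coeff ((g : G ⧸ U.toSubgroup)⁻¹ * a) := by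
  rw [ratProj_smul, proj_groupElt, toRat_single, MonoidAlgebra.coeff_single_mul_apply,
    PadicInt.coe_one, one_mul]

theorem injective_algebraMap_ratGroupAlgebra :
    Function.Injective (algebraMap (CompletedGroupAlgebra p G) (RatGroupAlgebra p G)) := by
  intro x y hxy
  refine ext_proj fun U => MonoidAlgebra.ext (Finsupp.ext fun a => PadicInt.ext ?_)
  rw [← coeff_toRat, ← coeff_toRat, ← ratProj_algebraMap, hxy, ratProj_algebraMap]

theorem mem_range_toRat_iff {A : Type*} [Group A] (y : MonoidAlgebra ℚ_[p] A) :
    (∃ x, toRat p A x = y) ↔ ∀ a, ∃ z : ℤ_[p], (z : ℚ_[p]) = y.coeff a := by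
  have h := MonoidAlgebra.range_map (M := A) (PadicInt.Coe.ringHom (p := p)).toAddMonoidHom
  exact Set.ext_iff.1 h y

/-- Families with coefficients in `ℤ_p` come from `ℤ_p⟦G⟧`. -/
theorem exists_algebraMap_eq {y : RatGroupAlgebra p G}
    (h : ∀ U, ∃ x, toRat p (G ⧸ U.toSubgroup) x = ratProj U y) :
    ∃ x, algebraMap (CompletedGroupAlgebra p G) (RatGroupAlgebra p G) x = y := by
  choose x hx using h
  refine ⟨⟨x, fun V U hVU => ?_⟩, ext_ratProj hx⟩
  refine MonoidAlgebra.ext (Finsupp.ext fun a => PadicInt.ext ?_)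
  rw [← coeff_toRat, ← coeff_toRat, groupRingProj_apply, toRat_mapDomain, hx, hx, mapDomain_ratProj]

theorem natCast_pow_mul_injective {A : Type*} [Group A] (n : ℕ) {x y : MonoidAlgebra ℚ_[p] A}
    (h : (p : MonoidAlgebra ℚ_[p] A) ^ n * x = p ^ n * y) : x = y := by
  have hp : (p : ℚ_[p]) ^ n ≠ 0 := pow_ne_zero _ (Nat.cast_ne_zero.2 (Fact.out : p.Prime).ne_zero)
  have hs : ∀ z : MonoidAlgebra ℚ_[p] A, (p : MonoidAlgebra ℚ_[p] A) ^ n * z =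
      (p : ℚ_[p]) ^ n • z :=
    fun z => by rw [← Nat.cast_pow, ← Nat.cast_pow, ← nsmul_eq_mul, Nat.cast_smul_eq_nsmul]
  rw [hs, hs] at h
  exact smul_right_injective _ hp h

variable {M : Type v} [AddCommGroup M] [Module (CompletedGroupAlgebra p G) M]
  (hs : ∀ U : OpenSubgroup G, ∃ (s : CompletedGroupAlgebra p G) (n : ℕ),
    (∀ x : M, s • x = 0) ∧ proj U s = p ^ n)

-- At level `U` the annihilator `s` acts on `Q` as `p ^ n`, which is injective.
include hs in
theorem linearMap_ratGroupAlgebra_eq_zero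
    (φ : M →ₗ[CompletedGroupAlgebra p G] RatGroupAlgebra p G) : φ = 0 := by
  refine LinearMap.ext fun m => ext_ratProj fun U => ?_
  obtain ⟨s, n, hsM, hsU⟩ := hs U
  refine natCast_pow_mul_injective n ?_
  rw [← map_natCast (toRat p (G ⧸ U.toSubgroup)), ← map_pow, ← hsU, ← ratProj_smul, ← map_smul, hsM,
    map_zero, LinearMap.zero_apply, map_zero, mul_zero]

include hs in
/-- Linear maps to `lim ℚ_p[G/U]` extend from the kernel of any linear map to `M`. -/
theorem exists_extension_ratGroupAlgebra {F : Type*} [AddCommGroup F]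
    [Module (CompletedGroupAlgebra p G) F] (π : F →ₗ[CompletedGroupAlgebra p G] M)
    (φ : LinearMap.ker π →ₗ[CompletedGroupAlgebra p G] RatGroupAlgebra p G) :
    ∃ ψ : F →ₗ[CompletedGroupAlgebra p G] RatGroupAlgebra p G,
      ψ ∘ₗ (LinearMap.ker π).subtype = φ := by
  choose s n hsM hsU using hs
  let t : OpenSubgroup G → F →ₗ[CompletedGroupAlgebra p G] LinearMap.ker π := fun U =>
    LinearMap.codRestrict _ (s U • LinearMap.id) fun x => by
      rw [LinearMap.mem_ker, LinearMap.smul_apply, map_smul, hsM]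
  have hp : (p : ℚ_[p]) ≠ 0 := Nat.cast_ne_zero.2 (Fact.out : p.Prime).ne_zero
  -- Since `s U • x` lies in the kernel of `π`, an extension must satisfy `p ^ n U * ψ(x) = φ(s U •
  -- x)` at level `U`; this is taken as the definition.
  let f : ∀ U : OpenSubgroup G, F → MonoidAlgebra ℚ_[p] (G ⧸ U.toSubgroup) :=
    fun U x => ((p : ℚ_[p]) ^ n U)⁻¹ • ratProj U (φ (t U x))
  have hf : ∀ U x, (p : MonoidAlgebra ℚ_[p] (G ⧸ U.toSubgroup)) ^ n U * f U x =
      ratProj U (φ (t U x)) := fun U x => by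
    rw [← Nat.cast_pow, ← nsmul_eq_mul, ← Nat.cast_smul_eq_nsmul ℚ_[p], Nat.cast_pow,
      smul_inv_smul₀ (pow_ne_zero _ hp)]
  have hsr : ∀ {U V : OpenSubgroup G}, V ≤ U → ∀ y : RatGroupAlgebra p G,
      ratProj U (s V • y) = p ^ n V * ratProj U y := fun {U V} hVU y => by
    rw [ratProj_smul, ← groupRingProj_proj hVU, hsU, map_pow, map_natCast, map_pow, map_natCast]
  have hcomm : ∀ U V x, s V • t U x = s U • t V x := fun U V x =>
    Subtype.ext (smul_comm (s V) (s U) x)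
  have hcompat : ∀ x (V U : OpenSubgroup G) (h : V ≤ U),
      MonoidAlgebra.mapDomainRingHom ℚ_[p] (quotMap h) (f V x) = f U x := fun x V U h => by
    have h1 : (p : MonoidAlgebra ℚ_[p] (G ⧸ U.toSubgroup)) ^ n V *
        MonoidAlgebra.mapDomainRingHom ℚ_[p] (quotMap h) (f V x) = ratProj U (φ (t V x)) := by
      rw [← mapDomain_ratProj h, ← hf V x, ← map_natCast (MonoidAlgebra.mapDomainRingHom ℚ_[p]
        (quotMap h)), ← map_pow, ← map_mul]
      rfl
    -- After clearing both powers of `p`, compatibility is the identity `s V • (s U • x) = s U • (s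
    -- V • x)`.
    refine natCast_pow_mul_injective (n V) (natCast_pow_mul_injective (n U) ?_)
    rw [h1, mul_left_comm, hf, ← hsr le_rfl, ← hsr h, ← map_smul φ, ← map_smul φ, hcomm]
  let g : F → RatGroupAlgebra p G := fun x => ratMk (fun U => f U x) (hcompat x)
  have hg : ∀ U x, (p : MonoidAlgebra ℚ_[p] (G ⧸ U.toSubgroup)) ^ n U * ratProj U (g x) =
      ratProj U (φ (t U x)) := hf
  refine ⟨{ toFun := g, map_add' := fun x y => ?_, map_smul' := fun r x => ?_ },
    LinearMap.ext fun x => ext_ratProj fun U => natCast_pow_mul_injective (n U) ?_⟩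
  · refine ext_ratProj fun U => natCast_pow_mul_injective (n U) ?_
    rw [map_add (ratProj U), mul_add, hg, hg, hg, map_add, map_add, map_add]
  · refine ext_ratProj fun U => natCast_pow_mul_injective (n U) ?_
    rw [RingHom.id_apply, ratProj_smul, mul_left_comm, hg, hg, map_smul, map_smul, ratProj_smul]
  · refine (hg U x).trans ?_
    rw [← hsr le_rfl, ← map_smul φ]
    rfl

end Rational

/-! ### The quotient `Q/Λ` and its coefficient characters. -/

section Quotient

variable (p : ℕ) [Fact p.Prime] (G : Type u) [CommGroup G] [TopologicalSpace G]

/-- The quotient of `lim ℚ_p[G/U]` by `ℤ_p⟦G⟧`. -/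
abbrev RatQuot : Type u :=
  RatGroupAlgebra p G ⧸
    LinearMap.range (Algebra.linearMap (CompletedGroupAlgebra p G) (RatGroupAlgebra p G))

variable {p G}

/-- An additive map on a quotient module. -/
def quotLift {R M A : Type*} [Ring R] [AddCommGroup M] [Module R M] [AddCommGroup A]
    (N : Submodule R M) (f : M →+ A) (h : ∀ x ∈ N, f x = 0) : M ⧸ N →+ A :=
  QuotientAddGroup.lift N.toAddSubgroup f h

/-- The character of `lim ℚ_p[G/U] / ℤ_p⟦G⟧` given by the coefficient at `1 ∈ G/U`. -/
def coeffChar (U : OpenSubgroup G) : RatQuot p G →+ Additive Circle :=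
  quotLift _ ((padicChar p).comp ((Finsupp.applyAddHom (1 : G ⧸ U.toSubgroup)).comp
    (MonoidAlgebra.coeffAddEquiv.toAddMonoidHom.comp (ratProj U).toAddMonoidHom))) (by
      rintro _ ⟨x, rfl⟩
      change padicChar p ((ratProj U (algebraMap _ (RatGroupAlgebra p G) x)).coeff 1) = 0
      rw [ratProj_algebraMap, coeff_toRat, padicChar_coe])

theorem coeffChar_mkQ (U : OpenSubgroup G) (y : RatGroupAlgebra p G) :
    coeffChar U (Submodule.mkQ _ y : RatQuot p G) = padicChar p ((ratProj U y).coeff 1) := rfl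

theorem coeffChar_groupElt_smul (U : OpenSubgroup G) (g : G) (y : RatGroupAlgebra p G) :
    coeffChar U (groupElt p g • (Submodule.mkQ _ y : RatQuot p G)) =
      padicChar p ((ratProj U y).coeff (g : G ⧸ U.toSubgroup)⁻¹) := by
  rw [← map_smul, coeffChar_mkQ, coeff_ratProj_groupElt_smul, mul_one]

theorem exists_toRat_eq_of_coeffChar (U : OpenSubgroup G) (y : RatGroupAlgebra p G)
    (h : ∀ g : G, coeffChar U (groupElt p g • (Submodule.mkQ _ y : RatQuot p G)) = 0) :
    ∃ x, toRat p (G ⧸ U.toSubgroup) x = ratProj U y := by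
  refine (mem_range_toRat_iff _).2 fun a => ?_
  obtain ⟨g, rfl⟩ := QuotientGroup.mk_surjective a
  have := h g⁻¹
  rwa [coeffChar_groupElt_smul, QuotientGroup.mk_inv, inv_inv, padicChar_eq_zero_iff] at this

/-- The hypothesis makes all coefficients of a representative at level `U` integral, a property
stable under multiplication by `ℤ_p⟦G⟧`. -/
theorem coeffChar_smul_eq_zero (U : OpenSubgroup G) {w : RatQuot p G}
    (h : ∀ g : G, coeffChar U (groupElt p g • w) = 0) (x : CompletedGroupAlgebra p G) :
    coeffChar U (x • w) = 0 := by
  obtain ⟨y, rfl⟩ := Submodule.mkQ_surjective _ w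
  obtain ⟨z, hz⟩ := exists_toRat_eq_of_coeffChar U y h
  rw [← map_smul, coeffChar_mkQ, ratProj_smul, ← hz, ← map_mul, coeff_toRat, padicChar_coe]

theorem coeffChar_smul_of_proj_eq_zero {U : OpenSubgroup G} (w : RatQuot p G)
    {x : CompletedGroupAlgebra p G} (hx : proj U x = 0) : coeffChar U (x • w) = 0 := by
  obtain ⟨y, rfl⟩ := Submodule.mkQ_surjective _ w
  rw [← map_smul, coeffChar_mkQ, ratProj_smul, hx, map_zero, zero_mul, MonoidAlgebra.coeff_zero,
    Finsupp.zero_apply, map_zero]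

theorem eq_zero_of_coeffChar {w : RatQuot p G}
    (h : ∀ (U : OpenSubgroup G) (g : G), coeffChar U (groupElt p g • w) = 0) : w = 0 := by
  obtain ⟨y, rfl⟩ := Submodule.mkQ_surjective _ w
  rw [Submodule.mkQ_apply, Submodule.Quotient.mk_eq_zero]
  exact exists_algebraMap_eq fun U => exists_toRat_eq_of_coeffChar U y (h U)

/-- An additive map on `ℤ_p⟦G⟧` that kills `G`, the multiples of `p ^ k` and the kernel of
`ℤ_p⟦G⟧ → ℤ_p[G/U]` vanishes. -/
theorem addMonoidHom_eq_zero {A : Type*} [AddCommGroup A] (f : CompletedGroupAlgebra p G →+ A)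
    (U : OpenSubgroup G) (k : ℕ) (hg : ∀ g, f (groupElt p g) = 0)
    (hk : ∀ x, f (p ^ k • x) = 0) (hU : ∀ x, proj U x = 0 → f x = 0)
    (x : CompletedGroupAlgebra p G) : f x = 0 := by
  obtain ⟨r, hr⟩ : ∃ r, proj U x = r := ⟨_, rfl⟩
  induction r using MonoidAlgebra.induction_linear generalizing x with
  | zero => exact hU x hr
  | add a b ha hb =>
    obtain ⟨y, hy⟩ := proj_surjective (p := p) U a
    rw [← add_sub_cancel y x, map_add, ha y hy,
      hb (x - y) (by rw [map_sub, hr, hy, add_sub_cancel_left]),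
      add_zero]
  | single a c =>
    obtain ⟨g, rfl⟩ := QuotientGroup.mk_surjective a
    obtain ⟨b, hb⟩ := Ideal.mem_span_singleton.1 (PadicInt.appr_spec k c)
    -- As `f` is only additive, the scalar `c` is split into a natural number and a multiple of `p ^
    -- k`.
    have hc : c = (c.appr k : ℤ_[p]) + p ^ k * b := by rw [← hb, add_sub_cancel]
    have h0 : proj U (x - (c.appr k • groupElt p g + p ^ k • (b • groupElt p g))) = 0 := by
      rw [map_sub, hr, map_add, map_nsmul, map_nsmul, map_smul, proj_groupElt, sub_eq_zero]
      rw [← Nat.cast_smul_eq_nsmul ℤ_[p], ← Nat.cast_smul_eq_nsmul ℤ_[p], smul_smul, ← add_smul,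
        MonoidAlgebra.smul_single, smul_eq_mul, mul_one, Nat.cast_pow, ← hc]
    rw [← sub_add_cancel x (c.appr k • groupElt p g + p ^ k • (b • groupElt p g)), map_add, hU _ h0,
      map_add, map_nsmul, hg, hk, smul_zero, add_zero, add_zero]

end Quotient

/-! ### Lifting compatible circle-valued families to `Q`. -/

section Lifting

variable {p : ℕ} [Fact p.Prime] {G : Type u} [CommGroup G] [TopologicalSpace G]
  [IsTopologicalGroup G] [CompactSpace G]


/-- A fibre is empty or a coset of `ℤ_p`, that is, a closed ball of radius `1`. -/
theorem isCompact_padicChar_fiber (z : Additive Circle) :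
    IsCompact {x : ℚ_[p] | padicChar p x = z} := by
  by_cases hz : ∃ x₀, padicChar p x₀ = z
  · obtain ⟨x₀, rfl⟩ := hz
    have h : {x : ℚ_[p] | padicChar p x = padicChar p x₀} = Metric.closedBall x₀ 1 := by
      ext x
      rw [Set.mem_ofPred_eq, mem_closedBall_iff_norm, ← sub_eq_zero, ← map_sub,
        padicChar_eq_zero_iff]
      exact ⟨by rintro ⟨y, hy⟩; rw [← hy]; exact y.2, fun h => ⟨⟨_, h⟩, rfl⟩⟩
    rw [h]
    exact isCompact_closedBall x₀ 1
  · have h : {x : ℚ_[p] | padicChar p x = z} = ∅ :=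
      Set.eq_empty_iff_forall_notMem.2 fun x hx => hz ⟨x, hx⟩
    rw [h]
    exact isCompact_empty

open Classical in
/-- A compatible family of functions on the quotients `G/U` with values in the image of the
standard character lifts to a compatible family of `ℚ_p`-valued functions. -/
theorem exists_ratGroupAlgebra_lift (c : ∀ U : OpenSubgroup G, G ⧸ U.toSubgroup → Additive Circle)
    (hc : ∀ U a, ∃ x, padicChar p x = c U a)
    (hcomp : ∀ (V U : OpenSubgroup G) (h : V ≤ U) (b : G ⧸ U.toSubgroup),
      c U b = ∑ a, if quotMap h a = b then c V a else 0) :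
    ∃ y : RatGroupAlgebra p G, ∀ U a, padicChar p ((ratProj U y).coeff a) = c U a := by
  let T : Set ((Σ U : OpenSubgroup G, G ⧸ U.toSubgroup) → ℚ_[p]) :=
    Set.pi Set.univ fun i => {x | padicChar p x = c i.1 i.2}
  have hT : IsCompact T := isCompact_univ_pi fun i => isCompact_padicChar_fiber _
  let F : ((Σ U : OpenSubgroup G, G ⧸ U.toSubgroup) → ℚ_[p]) →
      ∀ U : OpenSubgroup G, MonoidAlgebra ℚ_[p] (G ⧸ U.toSubgroup) :=
    fun f U => .ofCoeff (Finsupp.equivFunOnFinite.symm fun a => f ⟨U, a⟩)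
  -- `K V` imposes only the compatibilities that start at `V`. On `T` these conditions are closed,
  -- directed in `V` and satisfiable one at a time, so compactness satisfies them all together.
  let K : OpenSubgroup G → Set ((Σ U : OpenSubgroup G, G ⧸ U.toSubgroup) → ℚ_[p]) := fun V =>
    {f | ∀ (U : OpenSubgroup G) (h : V ≤ U), MonoidAlgebra.mapDomain (quotMap h) (F f V) = F f U}
  have hcoeff : ∀ f {V U : OpenSubgroup G} (h : V ≤ U) (b : G ⧸ U.toSubgroup),
      (MonoidAlgebra.mapDomain (quotMap h) (F f V)).coeff b =
        ∑ a, if quotMap h a = b then f ⟨V, a⟩ else 0 :=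
    fun f V U h b => coeff_mapDomain_eq_sum _ _ _
  have hK : ∀ V, IsClosed (K V) := fun V => by
    have : K V = ⋂ (U : OpenSubgroup G) (h : V ≤ U) (b : G ⧸ U.toSubgroup),
        {f | (∑ a, if quotMap h a = b then f ⟨V, a⟩ else 0) = f ⟨U, b⟩} := by
      ext f
      simp only [K, Set.mem_iInter, Set.mem_ofPred_eq, ← hcoeff]
      refine forall_congr' fun U => forall_congr' fun h => ?_
      rw [← MonoidAlgebra.coeff_inj, DFunLike.ext_iff]
      rfl
    rw [this]
    refine isClosed_iInter fun U => isClosed_iInter fun h => isClosed_iInter fun b =>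
      isClosed_eq (continuous_finsetSum _ fun a _ => ?_) (continuous_apply _)
    split_ifs
    · exact continuous_apply _
    · exact continuous_const
  have hmono : ∀ {V V' : OpenSubgroup G}, V' ≤ V → T ∩ K V' ⊆ T ∩ K V := fun {V V'} hV f hf => by
    refine ⟨hf.1, fun U h => ?_⟩
    rw [← hf.2 V hV, ← hf.2 U (hV.trans h)]
    have hq : quotMap (hV.trans h) = (quotMap h).comp (quotMap hV) :=
      MonoidHom.ext fun a => by
        obtain ⟨g, rfl⟩ := QuotientGroup.mk_surjective a
        rfl
    have := DFunLike.congr_fun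
      (MonoidAlgebra.mapDomainRingHom_comp (R := ℚ_[p]) (quotMap h) (quotMap hV)) (F f V')
    rw [← hq] at this
    exact this.symm
  have hne : ∀ V, (T ∩ K V).Nonempty := fun V => by
    choose x hx using hc
    have hid : ∀ a, quotMap (le_refl V) a = a := fun a => by
      obtain ⟨g, rfl⟩ := QuotientGroup.mk_surjective a
      rfl
    -- Lifts are chosen freely at level `V` and pushed forward to the subgroups containing `V`; at
    -- other levels any lift will do.
    let f : (Σ U : OpenSubgroup G, G ⧸ U.toSubgroup) → ℚ_[p] := fun i =>
      if h : V ≤ i.1 then ∑ a, if quotMap h a = i.2 then x V a else 0 else x i.1 i.2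
    have hfV : ∀ a, f ⟨V, a⟩ = x V a := fun a => by
      simp only [f, le_refl, dif_pos, hid]
      simp
    refine ⟨f, fun i _ => ?_, fun U h => ?_⟩
    · rw [Set.mem_ofPred_eq]
      by_cases h : V ≤ i.1
      · simp only [f, dif_pos h, map_sum]
        rw [hcomp V i.1 h i.2]
        refine Finset.sum_congr rfl fun a _ => ?_
        split_ifs
        · exact hx _ _
        · exact map_zero _
      · simp only [f, dif_neg h]
        exact hx _ _
    · ext b
      rw [hcoeff]
      simp only [hfV]
      change _ = f ⟨U, b⟩
      simp only [f, dif_pos h]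
  obtain ⟨f, hf⟩ := IsCompact.nonempty_iInter_of_directed_nonempty_isCompact_isClosed
    (fun V => T ∩ K V) (fun V V' => ⟨V ⊓ V', hmono inf_le_left, hmono inf_le_right⟩) hne
    (fun V => hT.inter_right (hK V)) (fun V => hT.isClosed.inter (hK V))
  rw [Set.mem_iInter] at hf
  exact ⟨ratMk (F f) fun V U h => (hf V).2 U h, fun U a => (hf U).1 ⟨U, a⟩ trivial⟩

end Lifting

section DualHom

variable {L : Type v} [AddCommGroup L] [TopologicalSpace L]

/-- A character of a topological group as an additive map. -/
def Dual.toHom (φ : Dual L) : L →+ Additive Circle :=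
  AddMonoidHom.mk' (fun x => Additive.ofMul (φ.eval x)) fun x y => φ.eval_add x y

/-- The character of a discrete group given by an additive map. -/
def Dual.ofHom [DiscreteTopology L] (f : L →+ Additive Circle) : Dual L :=
  Additive.ofMul (⟨AddMonoidHom.toMultiplicativeLeft f, continuous_of_discreteTopology⟩ :
    Multiplicative L →ₜ* Circle)

theorem Dual.toHom_ofHom [DiscreteTopology L] (f : L →+ Additive Circle) :
    (Dual.ofHom f).toHom = f := rfl

theorem Dual.toHom_injective : Function.Injective (Dual.toHom (L := L)) := fun _ _ h =>
  Dual.ext fun x => DFunLike.congr_fun h x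

theorem Dual.toHom_add_apply (φ ψ : Dual L) (x : L) : (φ + ψ).toHom x = φ.toHom x + ψ.toHom x := rfl

theorem Dual.toHom_smul_apply {R : Type u} [CommRing R] [Module R L] [DiscreteTopology L] (r : R)
    (φ : Dual L) (x : L) : (r • φ).toHom x = φ.toHom (r • x) := rfl

end DualHom

/-! ### The direct limit of the coinvariants along the norm maps. -/

section Limit

variable {p : ℕ} [Fact p.Prime] {G : Type u} [CommGroup G] [TopologicalSpace G]
theorem mem_cosetGroup_iff {V U : OpenSubgroup G} (h : V ≤ U) (a : G ⧸ V.toSubgroup) :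
    a ∈ cosetGroup G V U ↔ quotMap h a = 1 := by
  obtain ⟨g, rfl⟩ := QuotientGroup.mk_surjective a
  constructor
  · rintro ⟨u, hu, hug⟩
    rw [← hug]
    exact (QuotientGroup.eq_one_iff u).2 hu
  · exact fun hg => ⟨g, (QuotientGroup.eq_one_iff g).1 hg, rfl⟩

variable [IsTopologicalGroup G] [CompactSpace G]
variable {M : Type v} [AddCommGroup M] [Module (CompletedGroupAlgebra p G) M]

variable (M) in
open Classical in
/-- The canonical map from `M_U` to the direct limit. -/
def normOf (U : OpenSubgroup G) :
    Coinv p G M U →ₗ[CompletedGroupAlgebra p G] NormLimit p G M :=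
  Module.DirectLimit.of (CompletedGroupAlgebra p G) (OpenSubgroup G)ᵒᵈ
    (fun U => Coinv p G M (OrderDual.ofDual U))
    (fun U V _ => normMap p G M (OrderDual.ofDual V) (OrderDual.ofDual U)) (OrderDual.toDual U)

open Classical in
theorem normOf_normMap {V U : OpenSubgroup G} (h : V ≤ U) (x : Coinv p G M U) :
    normOf M V (normMap p G M V U x) = normOf M U x :=
  Module.DirectLimit.of_f (R := CompletedGroupAlgebra p G) (ι := (OpenSubgroup G)ᵒᵈ)
    (G := fun U => Coinv p G M (OrderDual.ofDual U))
    (f := fun U V _ => normMap p G M (OrderDual.ofDual V) (OrderDual.ofDual U))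
    (i := OrderDual.toDual U) (j := OrderDual.toDual V) (hij := h)

theorem exists_normOf (z : NormLimit p G M) : ∃ U x, normOf M U x = z := by
  classical
  obtain ⟨U, x, h⟩ := Module.DirectLimit.exists_of (R := CompletedGroupAlgebra p G)
    (ι := (OpenSubgroup G)ᵒᵈ) (G := fun U => Coinv p G M (OrderDual.ofDual U))
    (f := fun U V _ => normMap p G M (OrderDual.ofDual V) (OrderDual.ofDual U)) z
  exact ⟨OrderDual.ofDual U, x, h⟩

theorem exists_normMap_eq {U : OpenSubgroup G} {x y : Coinv p G M U}
    (h : normOf M U x = normOf M U y) :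
    ∃ V ≤ U, normMap p G M V U x = normMap p G M V U y := by
  classical
  obtain ⟨V, hV, h'⟩ := Module.DirectLimit.exists_eq_of_of_eq (R := CompletedGroupAlgebra p G)
    (ι := (OpenSubgroup G)ᵒᵈ) (G := fun U => Coinv p G M (OrderDual.ofDual U))
    (f := fun U V _ => normMap p G M (OrderDual.ofDual V) (OrderDual.ofDual U))
    (i := OrderDual.toDual U) h
  exact ⟨OrderDual.ofDual V, hV, h'⟩

/-- Additive maps on the direct limit from compatible families. -/
theorem exists_normLimit_lift {A : Type*} [AddCommGroup A]
    (ψ : ∀ U : OpenSubgroup G, Coinv p G M U →+ A)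
    (hψ : ∀ (V U : OpenSubgroup G), V ≤ U → ∀ x, ψ V (normMap p G M V U x) = ψ U x) :
    ∃ Ψ : NormLimit p G M →+ A, ∀ U x, Ψ (normOf M U x) = ψ U x := by
  have key : ∀ {U U' : OpenSubgroup G} {x : Coinv p G M U} {x' : Coinv p G M U'},
      normOf M U x = normOf M U' x' → ψ U x = ψ U' x' := fun {U U' x x'} h => by
    rw [← normOf_normMap (inf_le_left : U ⊓ U' ≤ U),
      ← normOf_normMap (inf_le_right : U ⊓ U' ≤ U')] at h
    obtain ⟨V, hV, h'⟩ := exists_normMap_eq h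
    rw [← hψ _ _ (inf_le_left : U ⊓ U' ≤ U), ← hψ _ _ (inf_le_right : U ⊓ U' ≤ U'), ← hψ _ _ hV, h',
      hψ _ _ hV]
  choose I r hr using exists_normOf (p := p) (G := G) (M := M)
  have hf : ∀ U x, ψ (I (normOf M U x)) (r (normOf M U x)) = ψ U x := fun U x => key (hr _)
  refine ⟨AddMonoidHom.mk' (fun z => ψ (I z) (r z)) fun z w => ?_, hf⟩
  obtain ⟨U, x, rfl⟩ := exists_normOf z
  obtain ⟨U', x', rfl⟩ := exists_normOf w
  rw [← normOf_normMap (inf_le_left : U ⊓ U' ≤ U), ← normOf_normMap (inf_le_right : U ⊓ U' ≤ U'),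
    ← map_add, hf, hf, hf, map_add]

-- This converts a norm sum over `U/V` into the fibre sum that computes a pushed-forward
-- coefficient. The inverse is there because the action of `g` moves the coefficient at `g⁻¹` to
-- `1`.
open Classical in
theorem sum_cosetGroup_inv {V U : OpenSubgroup G} (h : V ≤ U) {A : Type*} [AddCommMonoid A]
    (f : G ⧸ V.toSubgroup → A) :
    ∑ τ : cosetGroup G V U, f (τ : G ⧸ V.toSubgroup)⁻¹ =
      ∑ a, if quotMap h a = 1 then f a else 0 := by
  rw [← Finset.sum_filter, ← Equiv.sum_comp (Equiv.inv (cosetGroup G V U)),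
    Finset.sum_subtype (F := cosetGroupFintype G V U) (p := fun a => a ∈ cosetGroup G V U) _
      (fun a => by rw [Finset.mem_filter_univ, mem_cosetGroup_iff h])]
  refine Finset.sum_congr rfl fun τ _ => ?_
  simp

end Limit

/-! ### The isomorphism of `Hom(M, Q/Λ)` with the dual of the limit. -/

section Duality

variable {p : ℕ} [Fact p.Prime] {G : Type u} [CommGroup G] [TopologicalSpace G]
variable {M : Type v} [AddCommGroup M] [Module (CompletedGroupAlgebra p G) M]

/-- The character of `M_U` attached to a linear map `M → lim ℚ_p[G/U] / ℤ_p⟦G⟧`. -/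
def coinvChar (h : M →ₗ[CompletedGroupAlgebra p G] RatQuot p G) (U : OpenSubgroup G) :
    Coinv p G M U →+ Additive Circle :=
  quotLift _ ((coeffChar U).comp h.toAddMonoidHom) fun x hx => by
    rw [augmentationSubmodule_eq_smul_top] at hx
    induction hx using Submodule.smul_induction_on' with
    | smul r hr m _ =>
      change coeffChar U (h (r • m)) = 0
      rw [map_smul, coeffChar_smul_of_proj_eq_zero _ (proj_eq_zero_of_mem_augIdeal hr)]
    | add x _ y _ hx hy => rw [map_add, hx, hy, add_zero]

theorem coinvChar_mkQ (h : M →ₗ[CompletedGroupAlgebra p G] RatQuot p G) (U : OpenSubgroup G)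
    (m : M) :
    coinvChar h U ((augmentationSubmodule p G M U).mkQ m) = coeffChar U (h m) := rfl

variable [IsTopologicalGroup G] [CompactSpace G]

/-- The coefficient at `1 ∈ G/U` is the sum of the coefficients over `U/V` at level `V`, and the
norm map produces the same sum. -/
theorem coinvChar_normMap (h : M →ₗ[CompletedGroupAlgebra p G] RatQuot p G) {V U : OpenSubgroup G}
    (hVU : V ≤ U) (x : Coinv p G M U) :
    coinvChar h V (normMap p G M V U x) = coinvChar h U x := by
  classical
  obtain ⟨m, rfl⟩ := Submodule.mkQ_surjective _ x
  obtain ⟨y, hy⟩ := Submodule.mkQ_surjective _ (h m)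
  have hτ : ∀ τ : G ⧸ V.toSubgroup, coinvChar h V
      (cosetAction p G M V τ ((augmentationSubmodule p G M V).mkQ m)) =
        padicChar p ((ratProj V y).coeff τ⁻¹) := fun τ => by
    obtain ⟨g, rfl⟩ := QuotientGroup.mk_surjective τ
    rw [cosetAction_mk, ← map_smul, coinvChar_mkQ, map_smul, ← hy, coeffChar_groupElt_smul]
  rw [normMap_mkQ, map_sum, coinvChar_mkQ, ← hy, coeffChar_mkQ]
  simp_rw [hτ]
  rw [sum_cosetGroup_inv hVU (fun a => padicChar p ((ratProj V y).coeff a)),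
    ← mapDomain_ratProj hVU,
    coeff_mapDomain_eq_sum, map_sum]
  refine Finset.sum_congr rfl fun a _ => ?_
  split_ifs
  · rfl
  · exact (map_zero _).symm

/-- The character of `lim_U M_U` attached to a linear map `M → lim ℚ_p[G/U] / ℤ_p⟦G⟧`. -/
def limitChar (h : M →ₗ[CompletedGroupAlgebra p G] RatQuot p G) :
    NormLimit p G M →+ Additive Circle :=
  (exists_normLimit_lift (coinvChar h) fun _ _ hVU => coinvChar_normMap h hVU).choose

theorem limitChar_normOf (h : M →ₗ[CompletedGroupAlgebra p G] RatQuot p G)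
    (U : OpenSubgroup G) (m : M) :
    limitChar h (normOf M U ((augmentationSubmodule p G M U).mkQ m)) = coeffChar U (h m) :=
  (exists_normLimit_lift (coinvChar h) fun _ _ hVU => coinvChar_normMap h hVU).choose_spec U _

theorem normLimit_hom_ext {A : Type*} [AddCommGroup A] {f g : NormLimit p G M →+ A}
    (h : ∀ U m, f (normOf M U ((augmentationSubmodule p G M U).mkQ m)) =
      g (normOf M U ((augmentationSubmodule p G M U).mkQ m))) : f = g := by
  ext z
  obtain ⟨U, x, rfl⟩ := exists_normOf z
  obtain ⟨m, rfl⟩ := Submodule.mkQ_surjective _ x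
  exact h U m

variable (p G M) in
/-- The linear map from `Hom(M, lim ℚ_p[G/U] / ℤ_p⟦G⟧)` to the dual of the direct limit. -/
def dualityMap : (M →ₗ[CompletedGroupAlgebra p G] RatQuot p G) →ₗ[CompletedGroupAlgebra p G]
    Dual (NormLimit p G M) where
  toFun h := Dual.ofHom (limitChar h)
  map_add' h h' := Dual.toHom_injective <| normLimit_hom_ext fun U m => by
    rw [Dual.toHom_add_apply, Dual.toHom_ofHom, Dual.toHom_ofHom, Dual.toHom_ofHom,
      limitChar_normOf, limitChar_normOf, limitChar_normOf, LinearMap.add_apply, map_add]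
  map_smul' r h := Dual.toHom_injective <| normLimit_hom_ext fun U m => by
    rw [RingHom.id_apply, Dual.toHom_smul_apply, Dual.toHom_ofHom, Dual.toHom_ofHom,
      limitChar_normOf, ← map_smul, ← map_smul, limitChar_normOf,
      LinearMap.smul_apply, h.map_smul]

theorem dualityMap_injective : Function.Injective (dualityMap p G M) := by
  refine (injective_iff_map_eq_zero _).2 fun h hh => LinearMap.ext fun m => ?_
  refine eq_zero_of_coeffChar fun U g => ?_
  rw [← map_smul, ← limitChar_normOf]
  exact DFunLike.congr_fun (congrArg Dual.toHom hh) _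

/-- A character of the limit prescribes `coeffChar U (g • h m)` for all `U` and `g`. This determines
`h m` uniquely, so only existence and compatibility with scalars from `ℤ_p⟦G⟧` need work. -/
theorem dualityMap_surjective {d : ℕ} (e : G ≃ₜ* Multiplicative (Fin d → ℤ_[p]))
    (hfin : SystematicallyCoinvariantFinite p G M) : Function.Surjective (dualityMap p G M) := by
  classical
  intro φ
  have hfin' : ∀ U : OpenSubgroup G, Finite (Coinv p G M U) := hfin
  have hk := fun U : OpenSubgroup G => exists_pow_smul_eq_zero (p := p) (G := G) (Coinv p G M U)
  choose k hk using hk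
  let ψ : ∀ U : OpenSubgroup G, Coinv p G M U →+ Additive Circle := fun U =>
    φ.toHom.comp (normOf M U).toAddMonoidHom
  have hψ : ∀ {V U : OpenSubgroup G}, V ≤ U → ∀ x, ψ V (normMap p G M V U x) = ψ U x :=
    fun hVU x => congrArg φ.toHom (normOf_normMap hVU x)
  have hlift : ∀ m : M, ∃ w : RatQuot p G, ∀ (U : OpenSubgroup G) (g : G),
      coeffChar U (groupElt p g • w) =
        ψ U (groupElt p g • (augmentationSubmodule p G M U).mkQ m) := fun m => by
    obtain ⟨y, hy⟩ := exists_ratGroupAlgebra_lift (p := p)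
      (fun U a => ψ U (cosetAction p G M U a⁻¹ ((augmentationSubmodule p G M U).mkQ m)))
      -- Finiteness of `M_U` puts the prescribed values in the `p`-power torsion, the image of
      -- `padicChar`.
      (fun U a => exists_padicChar_eq (n := k U) (by rw [← map_nsmul, hk, map_zero]))
      (fun V U h b => by
        obtain ⟨g, rfl⟩ := QuotientGroup.mk_surjective b
        rw [← QuotientGroup.mk_inv, cosetAction_mk, ← map_smul, ← hψ h, normMap_mkQ, map_sum]
        have := sum_cosetGroup_inv h (fun a => ψ V (cosetAction p G M V a⁻¹
          ((augmentationSubmodule p G M V).mkQ (groupElt p g⁻¹ • m))))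
        simp only [inv_inv] at this
        rw [this]
        refine Fintype.sum_equiv (Equiv.mulLeft (g : G ⧸ V.toSubgroup)) _ _ fun a => ?_
        rw [Equiv.coe_mulLeft, map_mul, mul_inv_rev, map_mul, Module.End.mul_apply,
          ← QuotientGroup.mk_inv, cosetAction_mk, map_smul]
        congr 1
        exact propext mul_eq_left.symm)
    refine ⟨Submodule.mkQ _ y, fun U g => ?_⟩
    rw [coeffChar_groupElt_smul, hy, inv_inv, cosetAction_mk]
  have hlin : ∀ (m : M) (w : RatQuot p G), (∀ (U : OpenSubgroup G) (g : G),
      coeffChar U (groupElt p g • w) =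
        ψ U (groupElt p g • (augmentationSubmodule p G M U).mkQ m)) →
      ∀ (U : OpenSubgroup G) (x : CompletedGroupAlgebra p G), coeffChar U (x • w) =
        ψ U (x • (augmentationSubmodule p G M U).mkQ m) := fun m w hw U x => by
    let f₁ : CompletedGroupAlgebra p G →+ Additive Circle :=
      (coeffChar U).comp (LinearMap.toSpanSingleton _ _ w).toAddMonoidHom
    let f₂ : CompletedGroupAlgebra p G →+ Additive Circle :=
      (ψ U).comp (LinearMap.toSpanSingleton _ _
        ((augmentationSubmodule p G M U).mkQ m)).toAddMonoidHom
    have h₁ : ∀ x, f₁ x = coeffChar U (x • w) := fun _ => rfl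
    have h₂ : ∀ x, f₂ x = ψ U (x • (augmentationSubmodule p G M U).mkQ m) := fun _ => rfl
    -- Agreement on `G` spreads to `ℤ_p⟦G⟧` without any continuity assumption: both sides vanish on
    -- multiples of `p ^ k U` and on the kernel of `proj U`, which acts as zero on `M_U`.
    refine sub_eq_zero.1 (addMonoidHom_eq_zero (f₁ - f₂) U (k U) (fun g => ?_) (fun x => ?_)
      (fun x hx => ?_) x)
    · rw [AddMonoidHom.sub_apply, h₁, h₂, hw, sub_self]
    · rw [AddMonoidHom.sub_apply, map_nsmul, map_nsmul, h₂, h₁, ← map_nsmul (ψ U), hk, map_zero,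
        sub_zero, ← map_nsmul, smul_comm, coeffChar_smul_eq_zero]
      intro g
      rw [smul_comm, map_nsmul, hw, ← map_nsmul, hk, map_zero]
    · have hx' : x • (augmentationSubmodule p G M U).mkQ m = 0 := by
        rw [← map_smul, Submodule.mkQ_apply, Submodule.Quotient.mk_eq_zero,
          augmentationSubmodule_eq_smul_top]
        exact Submodule.smul_mem_smul ((mem_augIdeal_iff e).2 hx) trivial
      rw [AddMonoidHom.sub_apply, h₁, h₂, coeffChar_smul_of_proj_eq_zero _ hx, hx', map_zero,
        sub_zero]
  choose w hw using hlift
  have hw' := fun m => hlin m (w m) (hw m)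
  have huniq : ∀ {w₁ w₂ : RatQuot p G}, (∀ (U : OpenSubgroup G) (g : G),
      coeffChar U (groupElt p g • w₁) = coeffChar U (groupElt p g • w₂)) → w₁ = w₂ := fun h =>
    sub_eq_zero.1 <| eq_zero_of_coeffChar fun U g => by rw [smul_sub, map_sub, h, sub_self]
  let h : M →ₗ[CompletedGroupAlgebra p G] RatQuot p G :=
    { toFun := w
      map_add' := fun m m' => huniq fun U g => by
        rw [smul_add, map_add, hw, hw, hw, map_add, smul_add, map_add]
      map_smul' := fun r m => huniq fun U g => by
        rw [RingHom.id_apply, smul_smul, hw, hw',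
          (augmentationSubmodule p G M U).mkQ.map_smul, smul_smul] }
  refine ⟨h, Dual.toHom_injective <| normLimit_hom_ext fun U m => ?_⟩
  refine (limitChar_normOf h U m).trans ?_
  have := hw' m U 1
  rwa [one_smul, one_smul] at this

end Duality

end Iwasawa

end

theorem mainTheorem2 (p : ℕ) [Fact p.Prime] (d : ℕ) (hd : 1 ≤ d)
    (G : Type u) [CommGroup G] [TopologicalSpace G] [IsTopologicalGroup G] [CompactSpace G]
    (e : G ≃ₜ* Multiplicative (Fin d → ℤ_[p]))
    (M : Type u) [AddCommGroup M] [Module (Iwasawa.CompletedGroupAlgebra p G) M]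
    (hM : Module.Finite (Iwasawa.CompletedGroupAlgebra p G) M ∨ Iwasawa.IsCompactModule p G M)
    (hfin : Iwasawa.SystematicallyCoinvariantFinite p G M) :
    Nonempty
      (Abelian.Ext.{u}
          (ModuleCat.of (Iwasawa.CompletedGroupAlgebra p G) M)
          (ModuleCat.of (Iwasawa.CompletedGroupAlgebra p G) (Iwasawa.CompletedGroupAlgebra p G)) 1
        ≃ₗ[Iwasawa.CompletedGroupAlgebra p G]
        Iwasawa.Dual (Iwasawa.NormLimit p G M)) := by
  have hfin' : ∀ U : OpenSubgroup G, Finite (Iwasawa.Coinv p G M U) := hfin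
  have hMf : Module.Finite (Iwasawa.CompletedGroupAlgebra p G) M :=
    hM.elim id fun hM => hM.finite e (hfin ⊤)
  have hs := fun U : OpenSubgroup G => Iwasawa.exists_annihilator_proj_eq_pow (p := p) M U
  obtain ⟨δ⟩ := Iwasawa.nonempty_linearEquiv_ext_one M (Iwasawa.CompletedGroupAlgebra p G)
    (Iwasawa.RatGroupAlgebra p G) (Iwasawa.RatQuot p G) (Algebra.linearMap _ _)
    (Submodule.mkQ _) Iwasawa.injective_algebraMap_ratGroupAlgebra (Submodule.mkQ_surjective _)
    (LinearMap.exact_map_mkQ_range _) (Iwasawa.linearMap_ratGroupAlgebra_eq_zero hs)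
    (Iwasawa.ext_one_eq_zero_of_extension _ _ fun F _ _ π φ =>
      Iwasawa.exists_extension_ratGroupAlgebra hs π φ)
  exact ⟨δ.symm.trans (LinearEquiv.ofBijective (Iwasawa.dualityMap p G M)
    ⟨Iwasawa.dualityMap_injective, Iwasawa.dualityMap_surjective e hfin⟩)⟩
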